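/- Let $\Theta$ be a probability distribution on $(\mathbb{R}\cup\{+\infty\})^{\mathbb{N}^*}$, the offspring law of a branching random walk: a particle at $y$ has children at $y+x_1,y+x_2,\dots$, where $(x_1,x_2,\dots)$ has law $\Theta$, reproduction events are independent, and the value $+\infty$ means that the child does not exist. Sums over children ignore non-existing ones. Assume $$\mathbb{E}_\Theta\Big[\sum_i 1\Big]>1,\qquad \mathbb{E}_\Theta\Big[\sum_i e^{-x_i}\Big]=1,\qquad \mathbb{E}_\Theta\Big[\sum_i x_ie^{-x_i}\Big]=0,\qquad \mathbb{E}_\Theta\Big[\sum_i x_i^2e^{-x_i}\Big]\in(0,\infty).$$ For $x\in\mathbb{R}$ let $\mathbb{P}^*_x$ be the law of the spinal branching random walk: a particle $\xi_0$ starts at $x$; at each generation $n$ all particles reproduce independently, every particle other than $\xi_n$ according to $\Theta$, and $\xi_n$ according to the size-biased law $\Theta^*$ given by $\frac{d\Theta^*}{d\Theta}(x_1,x_2,\dots)=\sum_i e^{-x_i}$; given its offspring, $\xi_{n+1}$ is chosen among the children $u$ of $\xi_n$ with probability proportional to $e^{-X_u}$. Here $X_u$ is the position of the particle $u$. Let $\mathcal{F}_n$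 be the $\sigma$-algebra generated by the positions of the particles of generation at most $n$ and by $\xi_0,\dots,\xi_n$. Let $$R(x)=\sum_{n\ge0}\mathbb{P}^*_0\Big(X_{\xi_n}\ge -x,\ X_{\xi_n}<\min_{0\le k<n}X_{\xi_k}\Big)$$ be the renewal function of the strictly descending ladder heights of $(X_{\xi_n})_{n\ge0}$ (the condition on the minimum is void for $n=0$). For $x\ge0$ there is a probability measure $\mathbb{P}^+_x$ with $$\frac{d\mathbb{P}^+_x}{d\mathbb{P}^*_x}\Big|_{\mathcal{F}_n}=\frac{R(X_{\xi_n})}{R(x)}\,\mathbf{1}_{\min_{k\le n}X_{\xi_k}\ge0}\qquad\text{for all }n\ge0;$$ denote its expectation by $\mathbb{E}^+_x$. Let $f:\mathbb{R}_+\to\mathbb{R}_+$ be a bounded, non-increasing function with $\int_0^\infty yf(y)\,dy<\infty$. Then $$\mathbb{E}^+_x\Big[\sum_{k=0}^\infty f(X_{\xi_k})\Big]\longrightarrow0\quad\text{as }x\to\infty,$$ and this expectation is finite for every $x\ge0$. -/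

import Mathlib

open MeasureTheory Filter Topology
open scoped ENNReal

noncomputable section

namespace SpinalBRW

/-- A realization of the offspring of one particle: the displacements of its children, indexed by
`ℕ`; the value `⊤` in a slot means that the corresponding child does not exist. -/
abbrev Offspring : Type := ℕ → WithTop ℝ

/-- `e^{-a}`, with `e^{-∞} = 0`. -/
def weight (a : WithTop ℝ) : ℝ≥0∞ :=
  a.recTopCoe 0 fun r : ℝ => ENNReal.ofReal (Real.exp (-r))

/-- `a² e^{-a}` for an existing child, and `0` for a missing one. -/
def sqWeight (a : WithTop ℝ) : ℝ≥0∞ :=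
  a.recTopCoe 0 fun r : ℝ => ENNReal.ofReal (r ^ 2 * Real.exp (-r))

/-- `a e^{-a}` for an existing child, and `0` for a missing one. -/
def linWeight (a : WithTop ℝ) : ℝ :=
  a.recTopCoe 0 fun r : ℝ => r * Real.exp (-r)

/-- `1` for an existing child, and `0` for a missing one. -/
def countWeight (a : WithTop ℝ) : ℝ≥0∞ :=
  a.recTopCoe 0 fun _ : ℝ => 1

/-- The standing assumptions on the offspring law `Θ`: it is supercritical, in the boundary case,
and its variance parameter `σ²` is in `(0, ∞)`. Under `total_weight` and `variance_lt_top`, the function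
under the Bochner integral in `mean` is an almost surely absolutely convergent sum and integrable. -/
structure IsBoundaryCase (Θ : Measure Offspring) : Prop where
  prob : IsProbabilityMeasure Θ
  supercritical : 1 < ∫⁻ θ, ∑' i, countWeight (θ i) ∂Θ
  total_weight : ∫⁻ θ, ∑' i, weight (θ i) ∂Θ = 1
  mean : ∫ θ, ∑' i, linWeight (θ i) ∂Θ = 0
  variance_pos : 0 < ∫⁻ θ, ∑' i, sqWeight (θ i) ∂Θ
  variance_lt_top : ∫⁻ θ, ∑' i, sqWeight (θ i) ∂Θ < ∞

/-- The size-biased reproduction law `Θ*`, with `dΘ*/dΘ (x₁, x₂, …) = ∑ᵢ e^{-xᵢ}`. -/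
def sizeBiased (Θ : Measure Offspring) : Measure Offspring :=
  Θ.withDensity fun θ => ∑' i, weight (θ i)

/-- The joint law of the offspring of a spine particle and of the index of the child that continues
the spine: the offspring has law `Θ*` and, given it, child `i` is chosen with probability
proportional to `e^{-xᵢ}`. -/
def spineStep (Θ : Measure Offspring) : Measure (Offspring × ℕ) :=
  Measure.sum fun i : ℕ =>
    ((sizeBiased Θ).withDensity fun θ => weight (θ i) / ∑' j, weight (θ j)).map fun θ => (θ, i)

/-- Vertices of the Ulam-Harris tree: finite words over `ℕ`, the last letter being written first,
so that `i :: u` is the `i`-th child of `u`, `[]` is the root, and the length is the generation. -/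
abbrev Vertex : Type := List ℕ

/-- The first `n` letters of an infinite word, i.e. the vertex of generation `n` on a ray. -/
def rayVertex (r : ℕ → ℕ) : ℕ → Vertex
  | 0 => []
  | n + 1 => r n :: rayVertex r n

/-- The randomness driving the spinal branching random walk: the offspring of each particle off the
spine, and the offspring and the chosen child for each particle on the spine. -/
abbrev Noise : Type := (Vertex → Offspring) × (ℕ → Offspring × ℕ)

/-- All reproduction events are independent, with law `Θ` off the spine and `spineStep Θ` on it. -/
def noiseLaw (Θ : Measure Offspring) : Measure Noise :=
  (Measure.infinitePi fun _ : Vertex => Θ).prod (Measure.infinitePi fun _ : ℕ => spineStep Θ)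

/-- The ray of the tree that the spine follows. -/
def noiseRay (ν : Noise) : ℕ → ℕ := fun n => (ν.2 n).2

/-- The displacements of the children of the particle `u`. -/
def noiseOffspring (ν : Noise) (u : Vertex) : Offspring :=
  if u = rayVertex (noiseRay ν) u.length then (ν.2 u.length).1 else ν.1 u

/-- The positions of all particles, when the root is at `x`; non-existing particles (in particular
all descendants of a non-existing particle) are at `⊤`. -/
def noisePosition (x : ℝ) (ν : Noise) : Vertex → WithTop ℝ
  | [] => (x : WithTop ℝ)
  | i :: u => noisePosition x ν u + noiseOffspring ν u i

/-- The canonical space of branching random walks with a spine: positions of all particles, and a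
distinguished ray. -/
abbrev Path : Type := (Vertex → WithTop ℝ) × (ℕ → ℕ)

/-- The law `P*_x` of the spinal branching random walk started from a particle at `x`. -/
def spinalLaw (Θ : Measure Offspring) (x : ℝ) : Measure Path :=
  (noiseLaw Θ).map fun ν => (noisePosition x ν, noiseRay ν)

/-- The spine vertex `ξ_n`. -/
def spine (n : ℕ) (ω : Path) : Vertex := rayVertex ω.2 n

/-- The position `X_{ξ_n}` of the spine as a real number (it is almost surely not `⊤`). -/
def spinePos (n : ℕ) (ω : Path) : ℝ := (ω.1 (spine n ω)).untopD 0

/-- The σ-algebra `F_n` generated by the positions `X_u` with `|u| ≤ n` and by `ξ_0, …, ξ_n`. -/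
@[reducible] def sigmaUpTo (n : ℕ) : MeasurableSpace Path :=
  (⨆ u : Vertex, ⨆ _ : u.length ≤ n,
    MeasurableSpace.comap (fun ω : Path => ω.1 u) inferInstance) ⊔
  (⨆ k : ℕ, ⨆ _ : k ≤ n, MeasurableSpace.comap (spine k) ⊤)

/-- The renewal function of the strictly descending ladder heights of the spine,
`R(x) = ∑ₙ P*(X_{ξ_n} ≥ -x, X_{ξ_n} < min_{k < n} X_{ξ_k})`. -/
def renewal (Θ : Measure Offspring) (x : ℝ) : ℝ≥0∞ :=
  ∑' n : ℕ, spinalLaw Θ 0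
    {ω | -x ≤ spinePos n ω ∧ ∀ k < n, spinePos n ω < spinePos k ω}

open Classical in
/-- `R(X_{ξ_n}) 1_{min_{k ≤ n} X_{ξ_k} ≥ 0} / R(x)`. -/
def positiveDensity (Θ : Measure Offspring) (x : ℝ) (n : ℕ) (ω : Path) : ℝ≥0∞ :=
  if ∀ k ≤ n, 0 ≤ spinePos k ω then renewal Θ (spinePos n ω) / renewal Θ x else 0

/-- `Q` is the law `P⁺_x`: the probability measure whose density with respect to `P*_x` on `F_n` is
`R(X_{ξ_n}) 1_{min_{k ≤ n} X_{ξ_k} ≥ 0} / R(x)`, for every `n`. -/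
structure IsPositiveSpineLaw (Θ : Measure Offspring) (x : ℝ) (Q : Measure Path) : Prop where
  prob : IsProbabilityMeasure Q
  density : ∀ (n : ℕ) (A : Set Path), MeasurableSet[sigmaUpTo n] A →
    Q A = ∫⁻ ω in A, positiveDensity Θ x n ω ∂(spinalLaw Θ x)

theorem measurable_weight : Measurable weight :=
  WithTop.measurable_of_measurable_comp_coe
    (ENNReal.measurable_ofReal.comp (Real.measurable_exp.comp measurable_neg))

theorem measurable_weight_sum : Measurable fun θ : Offspring => ∑' i, weight (θ i) :=
  Measurable.tsum fun i => measurable_weight.comp (measurable_pi_apply i)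

theorem isProbabilityMeasure_spineStep {Θ : Measure Offspring} (hΘ : IsBoundaryCase Θ) :
    IsProbabilityMeasure (spineStep Θ) := by
  constructor
  have hm : ∀ i : ℕ, Measurable fun θ : Offspring => weight (θ i) / ∑' j, weight (θ j) :=
    fun i => (measurable_weight.comp (measurable_pi_apply i)).div measurable_weight_sum
  have h1 : ∀ i : ℕ, Measurable fun θ : Offspring => (θ, i) := fun i => by fun_prop
  simp only [spineStep, Measure.sum_apply _ MeasurableSet.univ,
    Measure.map_apply (h1 _) MeasurableSet.univ, Set.preimage_univ,
    withDensity_apply _ MeasurableSet.univ, Measure.restrict_univ]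
  rw [← lintegral_tsum fun i => (hm i).aemeasurable, sizeBiased,
    lintegral_withDensity_eq_lintegral_mul _ measurable_weight_sum
      (Measurable.tsum hm), ← hΘ.total_weight]
  have hfin : ∀ᵐ θ ∂Θ, ∑' i, weight (θ i) < ∞ :=
    ae_lt_top measurable_weight_sum (by rw [hΘ.total_weight]; exact ENNReal.one_ne_top)
  refine lintegral_congr_ae ?_
  filter_upwards [hfin] with θ hθ
  simp only [Pi.mul_apply, div_eq_mul_inv, ENNReal.tsum_mul_right]
  by_cases h0 : ∑' i, weight (θ i) = 0
  · simp [h0]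
  · rw [ENNReal.mul_inv_cancel h0 hθ.ne, mul_one]

theorem measurable_withTop_add :
    Measurable fun p : WithTop ℝ × WithTop ℝ => p.1 + p.2 := by
  have h : (fun p : WithTop ℝ × WithTop ℝ => p.1 + p.2) = fun p =>
      if p.1 = ⊤ then ⊤ else if p.2 = ⊤ then ⊤ else
        ((p.1.untopD 0 + p.2.untopD 0 : ℝ) : WithTop ℝ) := by
    funext ⟨a, b⟩
    induction a using WithTop.recTopCoe <;> induction b using WithTop.recTopCoe <;> simp
  rw [h]
  refine Measurable.ite (measurable_fst (measurableSet_singleton _)) measurable_const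
    (Measurable.ite (measurable_snd (measurableSet_singleton _)) measurable_const ?_)
  fun_prop

theorem measurableSet_rayVertex_eq (n : ℕ) (u : Vertex) :
    MeasurableSet {r : ℕ → ℕ | u = rayVertex r n} := by
  induction n generalizing u with
  | zero => simp [rayVertex]
  | succ n ih =>
    cases u with
    | nil => simp [rayVertex]
    | cons i u =>
      simp only [rayVertex, List.cons.injEq]
      exact (measurableSet_eq_fun measurable_const (measurable_pi_apply n)).inter (ih u)

theorem measurable_noiseRay : Measurable noiseRay :=
  measurable_pi_lambda _ fun n => by unfold noiseRay; fun_prop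

theorem measurable_noisePosition (x : ℝ) : Measurable (noisePosition x) := by
  refine measurable_pi_lambda _ fun u => ?_
  induction u with
  | nil => exact measurable_const
  | cons i u ih =>
    have ho : Measurable fun ν : Noise => noiseOffspring ν u :=
      Measurable.ite (measurable_noiseRay (measurableSet_rayVertex_eq u.length u))
        (by fun_prop) (by fun_prop)
    exact measurable_withTop_add.comp (ih.prodMk ((measurable_pi_apply i).comp ho))

/-- The law of the spinal branching random walk is a probability measure. -/
theorem isProbabilityMeasure_spinalLaw {Θ : Measure Offspring} (hΘ : IsBoundaryCase Θ) (x : ℝ) :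
    IsProbabilityMeasure (spinalLaw Θ x) := by
  have := hΘ.prob
  have := isProbabilityMeasure_spineStep hΘ
  unfold spinalLaw noiseLaw
  exact Measure.isProbabilityMeasure_map
    ((measurable_noisePosition x).prodMk measurable_noiseRay).aemeasurable

end SpinalBRW

end

/-!
Under `P*` the spine is a random walk, centered by the boundary case, and `P⁺_x` turns it into the
Doob transform by `R` of that walk started at `x` and killed below `0`. Hence the expected number of
visits of the spine to `[a, a + 1)` under `P⁺_x` is at most `R(a + 1) / R(x)` times the Green
function of the killed walk. Cutting each trajectory at its first overall minimum, this Green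
function is bounded by a constant times the renewal mass, in a window of length `a + 1` just above
`-x`, of the strictly descending ladder heights. That mass is at most `R(x)` and at most linear in
`a`, and `R` grows at most linearly. Summing over `a` against `f`, the terms are dominated by a
multiple of `f(a) R(a + 1)`, which is summable because `∫ y f(y) dy < ∞`; as each term vanishes when
`R(x) → ∞`, so does the sum.
-/

noncomputable section

namespace SpinalBRW

section Walk

variable {E : Type*}

/-- The walk with steps `g (ω 0), g (ω 1), …`, started at `0`. -/
def walk (g : E → ℝ) (n : ℕ) (ω : ℕ → E) : ℝ := ∑ i ∈ Finset.range n, g (ω i)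

/-- The sequence `ω` without its first `n` terms. -/
def shift (n : ℕ) (ω : ℕ → E) : ℕ → E := fun i => ω (n + i)

/-- The sequence `ω'`, preceded by the first `n` terms of `ω`. -/
def splice (n : ℕ) (ω ω' : ℕ → E) : ℕ → E := fun i => if i < n then ω i else ω' (i - n)

/-- The involution of `ℕ` that reverses the order of the first `n` numbers. -/
def reverseIndex (n i : ℕ) : ℕ := if i < n then n - 1 - i else i

/-- The sequence `ω` with its first `n` terms in reversed order. -/
def reversePrefix (n : ℕ) (ω : ℕ → E) : ℕ → E := fun i => ω (reverseIndex n i)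

theorem reverseIndex_injective (n : ℕ) : Function.Injective (reverseIndex n) := by
  intro i j h
  grind [reverseIndex]

@[simp] theorem walk_zero (g : E → ℝ) (ω : ℕ → E) : walk g 0 ω = 0 := by simp [walk]

theorem walk_succ (g : E → ℝ) (n : ℕ) (ω : ℕ → E) : walk g (n + 1) ω = walk g n ω + g (ω n) :=
  Finset.sum_range_succ _ _

theorem walk_add (g : E → ℝ) (n k : ℕ) (ω : ℕ → E) :
    walk g (n + k) ω = walk g n ω + walk g k (shift n ω) :=
  Finset.sum_range_add _ _ _

theorem walk_neg (g : E → ℝ) (n : ℕ) (ω : ℕ → E) :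
    walk (fun e => -g e) n ω = -walk g n ω := by simp [walk]

theorem dependsOn_walk (g : E → ℝ) (n : ℕ) : DependsOn (walk g n) (Set.Iio n) :=
  fun _ _ h => Finset.sum_congr rfl fun i hi => by rw [h i (Finset.mem_range.1 hi)]

theorem walk_congr (g : E → ℝ) {n j : ℕ} (hj : j ≤ n) {ω ω' : ℕ → E}
    (h : ∀ i ∈ Set.Iio n, ω i = ω' i) : walk g j ω = walk g j ω' :=
  (dependsOn_walk g j).mono (Set.Iio_subset_Iio hj) h

theorem walk_reversePrefix (g : E → ℝ) {n j : ℕ} (h : j ≤ n) (ω : ℕ → E) :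
    walk g j (reversePrefix n ω) = walk g n ω - walk g (n - j) ω := by
  have hsum : ∑ i ∈ Finset.range j, g (reversePrefix n ω i) =
      ∑ i ∈ Finset.range j, g (shift (n - j) ω (j - 1 - i)) := by
    refine Finset.sum_congr rfl fun i hi => ?_
    simp only [reversePrefix, reverseIndex, shift]
    grind
  have hadd := walk_add g (n - j) j ω
  rw [Nat.sub_add_cancel h] at hadd
  rw [walk, hsum, Finset.sum_range_reflect fun i => g (shift (n - j) ω i), hadd,
    add_sub_cancel_left, walk]

theorem splice_of_lt {n i : ℕ} (h : i < n) (ω ω' : ℕ → E) : splice n ω ω' i = ω i := if_pos h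

theorem shift_splice (n : ℕ) (ω ω' : ℕ → E) : shift n (splice n ω ω') = ω' := by
  ext i
  simp [shift, splice]

theorem preimage_splice_pi (n : ℕ) (s : Finset ℕ) (t : ℕ → Set E) :
    (fun p : (ℕ → E) × (ℕ → E) => splice n p.1 p.2) ⁻¹' (s : Set ℕ).pi t =
      (↑{i ∈ s | i < n} : Set ℕ).pi t ×ˢ
        (↑({i ∈ s | ¬i < n}.image (· - n)) : Set ℕ).pi fun i => t (i + n) := by
  ext ⟨ω, ω'⟩
  simp only [Set.mem_preimage, Set.mem_pi, Set.mem_prod, Finset.mem_coe, Finset.mem_filter,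
    Finset.mem_image, splice]
  constructor
  · refine fun h => ⟨fun i hi => by simpa [hi.2] using h i hi.1, ?_⟩
    rintro _ ⟨i, ⟨hi, hn⟩, rfl⟩
    simpa [hn, Nat.sub_add_cancel (not_lt.1 hn)] using h i hi
  · rintro ⟨h_lt, h_ge⟩ i hi
    by_cases hn : i < n
    · simpa [hn] using h_lt i ⟨hi, hn⟩
    · simpa [hn, Nat.sub_add_cancel (not_lt.1 hn)] using h_ge (i - n) ⟨i, ⟨hi, hn⟩, rfl⟩

variable [MeasurableSpace E]

@[fun_prop] theorem measurable_walk {g : E → ℝ} (hg : Measurable g) (n : ℕ) :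
    Measurable (walk g n) := by
  unfold walk; fun_prop

@[fun_prop] theorem measurable_shift (n : ℕ) : Measurable (shift n : (ℕ → E) → ℕ → E) := by
  unfold shift; fun_prop

theorem measurable_splice (n : ℕ) :
    Measurable fun p : (ℕ → E) × (ℕ → E) => splice n p.1 p.2 := by
  refine measurable_pi_lambda _ fun i => ?_
  by_cases h : i < n <;> simp only [splice, h, if_true, if_false] <;> fun_prop

theorem measurable_reversePrefix (n : ℕ) :
    Measurable (reversePrefix n : (ℕ → E) → ℕ → E) := by
  unfold reversePrefix; fun_prop

/-- The law of an i.i.d. sequence with common law `m`. -/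
abbrev iidLaw (m : Measure E) : Measure (ℕ → E) :=
  Measure.infinitePi fun _ : ℕ => m

variable (m : Measure E) [IsProbabilityMeasure m]

theorem map_splice (n : ℕ) :
    ((iidLaw m).prod (iidLaw m)).map (fun p => splice n p.1 p.2) = iidLaw m := by
  refine Measure.eq_infinitePi _ fun s t ht => ?_
  have hinj : Set.InjOn (· - n) (↑{i ∈ s | ¬i < n} : Set ℕ) := by
    intro i hi j hj hij
    simp only [Finset.coe_filter, Set.mem_ofPred_eq] at hi hj hij
    omega
  rw [Measure.map_apply (measurable_splice n) (.pi s.countable_toSet fun i _ => ht i),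
    preimage_splice_pi, Measure.prod_prod, Measure.infinitePi_pi _ fun i _ => ht i,
    Measure.infinitePi_pi _ fun i _ => ht _, Finset.prod_image hinj,
    ← Finset.prod_filter_mul_prod_filter_not s (· < n)]
  congr 1
  refine Finset.prod_congr rfl fun i hi => ?_
  rw [Nat.sub_add_cancel (not_lt.1 (Finset.mem_filter.1 hi).2)]

theorem lintegral_shift (n : ℕ) {F : (ℕ → E) → (ℕ → E) → ℝ≥0∞}
    (hF : Measurable (Function.uncurry F)) (hdep : ∀ ω', DependsOn (F · ω') (Set.Iio n)) :
    ∫⁻ ω, F ω (shift n ω) ∂iidLaw m = ∫⁻ ω, ∫⁻ ω', F ω ω' ∂iidLaw m ∂iidLaw m := by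
  conv_lhs => rw [← map_splice m n]
  have hFn : Measurable fun ω => F ω (shift n ω) :=
    hF.comp (measurable_id.prodMk (measurable_shift n))
  rw [lintegral_map hFn (measurable_splice n)]
  refine Eq.trans (lintegral_congr fun p => ?_) (lintegral_prod _ hF.aemeasurable)
  rw [shift_splice]
  exact hdep p.2 fun i hi => splice_of_lt hi p.1 p.2

theorem iidLaw_setOf_shift (n : ℕ) {S : Set ((ℕ → E) × (ℕ → E))} (hS : MeasurableSet S)
    (hdep : ∀ ω', DependsOn (fun ω => (ω, ω') ∈ S) (Set.Iio n)) :
    iidLaw m {ω | (ω, shift n ω) ∈ S} = ∫⁻ ω, iidLaw m {ω' | (ω, ω') ∈ S} ∂iidLaw m := by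
  have h := lintegral_shift m n (F := fun ω ω' => S.indicator 1 (ω, ω'))
    (measurable_one.indicator hS) fun ω' _ _ h =>
      Set.indicator_const_eq_indicator_const (iff_of_eq (hdep ω' h))
  have hshift : Measurable fun ω : ℕ → E => (ω, shift n ω) := by fun_prop
  have hsect : ∀ ω, MeasurableSet {ω' : ℕ → E | (ω, ω') ∈ S} := fun ω =>
    measurable_prodMk_left hS
  exact (lintegral_indicator_one (hshift hS)).symm.trans
    (h.trans (lintegral_congr fun ω => lintegral_indicator_one (hsect ω)))

theorem iidLaw_inter_preimage_shift (n : ℕ) {A D : Set (ℕ → E)} (hA : MeasurableSet A)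
    (hD : MeasurableSet D) (hdep : DependsOn (· ∈ A) (Set.Iio n)) :
    iidLaw m (A ∩ shift n ⁻¹' D) = iidLaw m A * iidLaw m D := by
  have hsect : ∀ ω, iidLaw m {ω' | (ω, ω') ∈ A ×ˢ D} = A.indicator (fun _ => iidLaw m D) ω := by
    intro ω
    by_cases hω : ω ∈ A <;> simp [hω]
  have h := iidLaw_setOf_shift m n (hA.prod hD) fun ω' ω₁ ω₂ h₁₂ => by
    simp only [Set.mem_prod, hdep h₁₂]
  rw [lintegral_congr hsect, lintegral_indicator_const hA, mul_comm] at h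
  exact h

theorem lintegral_next (n : ℕ) {F : (ℕ → E) → E → ℝ≥0∞} (hF : Measurable (Function.uncurry F))
    (hdep : ∀ e, DependsOn (F · e) (Set.Iio n)) :
    ∫⁻ ω, F ω (ω n) ∂iidLaw m = ∫⁻ ω, ∫⁻ e, F ω e ∂m ∂iidLaw m := by
  have h := lintegral_shift m n (F := fun ω ω' => F ω (ω' 0))
    (hF.comp (measurable_fst.prodMk ((measurable_pi_apply 0).comp measurable_snd)))
    fun ω' => hdep (ω' 0)
  refine h.trans (lintegral_congr fun ω => ?_)
  exact (measurePreserving_eval_infinitePi (fun _ : ℕ => m) 0).lintegral_comp hF.of_uncurry_left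

theorem iidLaw_setOf_next (n : ℕ) {S : Set ((ℕ → E) × E)} (hS : MeasurableSet S)
    (hdep : ∀ e, DependsOn (fun ω => (ω, e) ∈ S) (Set.Iio n)) :
    iidLaw m {ω | (ω, ω n) ∈ S} = ∫⁻ e, iidLaw m {ω | (ω, e) ∈ S} ∂m := by
  have hF : Measurable (Function.uncurry fun ω e => S.indicator (1 : (ℕ → E) × E → ℝ≥0∞) (ω, e)) :=
    measurable_one.indicator hS
  have h := lintegral_next m n hF fun e _ _ h =>
    Set.indicator_const_eq_indicator_const (iff_of_eq (hdep e h))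
  rw [lintegral_lintegral_swap hF.aemeasurable] at h
  have hnext : Measurable fun ω : ℕ → E => (ω, ω n) := by fun_prop
  exact (lintegral_indicator_one (hnext hS)).symm.trans
    (h.trans (lintegral_congr fun e => lintegral_indicator_one (measurable_prodMk_right hS)))

theorem iidLaw_preimage_reversePrefix (n : ℕ) {s : Set (ℕ → E)} (hs : MeasurableSet s) :
    iidLaw m (reversePrefix n ⁻¹' s) = iidLaw m s := by
  rw [← Measure.map_apply (measurable_reversePrefix n) hs]
  congr 1
  exact Measure.map_infinitePi_infinitePi_of_inj (P := fun _ => m) (reverseIndex_injective n)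

end Walk

section Ladder

theorem exists_pos_measure_ge {E : Type*} [MeasurableSpace E] (m : Measure E) {g : E → ℝ}
    (hpos : 0 < m {e | 0 < g e}) : ∃ ε : ℝ, 0 < ε ∧ 0 < m {e | ε ≤ g e} := by
  by_contra! h
  have hcover : {e | 0 < g e} ⊆ ⋃ n : ℕ, {e | 1 / ((n : ℝ) + 1) ≤ g e} := by
    intro e he
    obtain ⟨n, hn⟩ := exists_nat_one_div_lt (show (0 : ℝ) < g e from he)
    exact Set.mem_iUnion.2 ⟨n, hn.le⟩
  refine hpos.ne' (measure_mono_null hcover (measure_iUnion_null fun n => ?_))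
  exact le_antisymm (h _ (by positivity)) bot_le

theorem tsum_measure_le_of_forall_lt_add {α : Type*} [MeasurableSpace α] (μ : Measure α)
    {B : ℕ → Set α} (hB : ∀ n, MeasurableSet (B n)) {k : ℕ}
    (hlt : ∀ ω i j, ω ∈ B i → ω ∈ B j → j < i + k) : ∑' n, μ (B n) ≤ k * μ Set.univ := by
  have hcount : ∀ ω, ∑' n, (B n).indicator (1 : α → ℝ≥0∞) ω ≤ k := by
    intro ω
    by_cases hex : ∃ n, ω ∈ B n
    · classical
      have hsupp : ∀ n ∉ Finset.Ico (Nat.find hex) (Nat.find hex + k),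
          (B n).indicator (1 : α → ℝ≥0∞) ω = 0 := fun n hn =>
        Set.indicator_of_notMem (fun hmem => hn (Finset.mem_Ico.2
          ⟨Nat.find_min' hex hmem, hlt ω _ n (Nat.find_spec hex) hmem⟩)) _
      rw [tsum_eq_sum hsupp]
      refine (Finset.sum_le_card_nsmul _ _ 1 fun n _ => ?_).trans (by simp)
      exact Set.indicator_apply_le' (fun _ => le_rfl) fun _ => zero_le_one
    · push Not at hex
      simp [hex]
  calc ∑' n, μ (B n) = ∫⁻ ω, ∑' n, (B n).indicator 1 ω ∂μ := by
        rw [lintegral_tsum fun n => (measurable_one.indicator (hB n)).aemeasurable]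
        simp only [lintegral_indicator_one (hB _)]
    _ ≤ ∫⁻ _, k ∂μ := lintegral_mono hcount
    _ = k * μ Set.univ := lintegral_const _

variable {E : Type*} {g : E → ℝ}

/-- The event that the walk is at a weakly ascending ladder epoch at time `n`. -/
def weakAscent (g : E → ℝ) (n : ℕ) : Set (ℕ → E) := {ω | ∀ j ≤ n, walk g j ω ≤ walk g n ω}

/-- The event that the walk is at a strictly descending ladder epoch at time `n`. -/
def strictDescent (g : E → ℝ) (n : ℕ) : Set (ℕ → E) := {ω | ∀ j < n, walk g n ω < walk g j ω}

/-- The event that the walk started at `x` is nonnegative up to time `n`. -/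
def survival (g : E → ℝ) (x : ℝ) (n : ℕ) : Set (ℕ → E) := {ω | ∀ j ≤ n, 0 ≤ x + walk g j ω}

theorem dependsOn_weakAscent (n : ℕ) : DependsOn (· ∈ weakAscent g n) (Set.Iio n) :=
  fun ω ω' h => by
    simp +contextual only [weakAscent, Set.mem_ofPred_eq, walk_congr g _ h, le_refl]

theorem dependsOn_strictDescent (n : ℕ) : DependsOn (· ∈ strictDescent g n) (Set.Iio n) :=
  fun ω ω' h => by
    simp +contextual only [strictDescent, Set.mem_ofPred_eq, walk_congr g _ h, le_refl,
      LT.lt.le]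

theorem walk_le_zero_of_mem_strictDescent {n : ℕ} {ω : ℕ → E} (h : ω ∈ strictDescent g n) :
    walk g n ω ≤ 0 := by
  rcases n.eq_zero_or_pos with rfl | hn
  · simp
  · simpa using (h 0 hn).le

theorem strictDescent_subset_weakAscent_neg (n : ℕ) :
    strictDescent g n ⊆ weakAscent (fun e => -g e) n := by
  intro ω h j hj
  rw [walk_neg, walk_neg, neg_le_neg_iff]
  rcases hj.lt_or_eq with hj | rfl
  exacts [(h j hj).le, le_rfl]

theorem survival_zero_eq_preimage_weakAscent (n : ℕ) :
    survival g 0 n = reversePrefix n ⁻¹' weakAscent g n := by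
  ext ω
  simp only [survival, weakAscent, Set.mem_preimage, Set.mem_ofPred_eq, zero_add,
    walk_reversePrefix g le_rfl, Nat.sub_self, walk_zero, sub_zero]
  constructor
  · intro h j hj
    rw [walk_reversePrefix g hj]
    linarith [h (n - j) (Nat.sub_le n j)]
  · intro h j hj
    have hrev := h (n - j) (Nat.sub_le n j)
    rw [walk_reversePrefix g (Nat.sub_le n j), Nat.sub_sub_self hj] at hrev
    linarith

variable [MeasurableSpace E]

theorem measurableSet_weakAscent (hg : Measurable g) (n : ℕ) :
    MeasurableSet (weakAscent g n) := by
  simp only [weakAscent, measurableSet_setOfPred]; fun_prop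

theorem measurableSet_strictDescent (hg : Measurable g) (n : ℕ) :
    MeasurableSet (strictDescent g n) := by
  simp only [strictDescent, measurableSet_setOfPred]; fun_prop

theorem measurableSet_survival (hg : Measurable g) (x : ℝ) (n : ℕ) :
    MeasurableSet (survival g x n) := by
  simp only [survival, measurableSet_setOfPred]; fun_prop

variable (m : Measure E) [IsProbabilityMeasure m]

theorem pow_mul_iidLaw_le (hg : Measurable g) (n k : ℕ) {A : Set (ℕ → E)} (hA : MeasurableSet A)
    (hdep : DependsOn (· ∈ A) (Set.Iio n)) (ε : ℝ) :
    m {e | ε ≤ g e} ^ k * iidLaw m A ≤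
      iidLaw m (A ∩ {ω | walk g n ω + k * ε ≤ walk g (n + k) ω}) := by
  have hge : MeasurableSet {e | ε ≤ g e} := measurableSet_le measurable_const hg
  set D : Set (ℕ → E) := (Finset.range k : Set ℕ).pi fun _ => {e | ε ≤ g e}
  have hD : iidLaw m D = m {e | ε ≤ g e} ^ k := by
    rw [Measure.infinitePi_pi _ fun _ _ => hge, Finset.prod_const, Finset.card_range]
  have hwalk : ∀ ω ∈ D, k * ε ≤ walk g k ω := by
    intro ω hω
    simpa [walk] using Finset.card_nsmul_le_sum (Finset.range k) (fun i => g (ω i)) ε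
      fun i hi => hω i (Finset.mem_coe.2 hi)
  rw [← hD, mul_comm, ← iidLaw_inter_preimage_shift m n hA
    (.pi (Finset.countable_toSet _) fun _ _ => hge) hdep]
  refine measure_mono (Set.inter_subset_inter_right A fun ω hω => ?_)
  rw [Set.mem_ofPred_eq, walk_add]
  linarith [hwalk _ hω]

/- With `k ε > 1`, from a ladder epoch in the window the walk exceeds the window after `k` steps
with probability at least `δ ^ k`, and it then has no further ladder epoch there. -/
theorem exists_weakAscent_bound (hg : Measurable g) (hpos : 0 < m {e | 0 < g e}) :
    ∃ C : ℝ≥0∞, C ≠ ∞ ∧ ∀ b : ℝ,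
      ∑' n : ℕ, iidLaw m (walk g n ⁻¹' Set.Icc b (b + 1) ∩ weakAscent g n) ≤ C := by
  obtain ⟨ε, hε, hδ⟩ := exists_pos_measure_ge m hpos
  obtain ⟨k, hk⟩ := exists_nat_gt (1 / ε)
  rw [div_lt_iff₀ hε] at hk
  set δ := m {e | ε ≤ g e}
  have hδk : δ ^ k ≠ 0 := pow_ne_zero _ hδ.ne'
  refine ⟨k / δ ^ k, ENNReal.div_ne_top (ENNReal.natCast_ne_top k) hδk, fun b => ?_⟩
  set A : ℕ → Set (ℕ → E) := fun n => walk g n ⁻¹' Set.Icc b (b + 1) ∩ weakAscent g n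
  set B : ℕ → Set (ℕ → E) := fun n => A n ∩ {ω | walk g n ω + k * ε ≤ walk g (n + k) ω}
  have hA : ∀ n, MeasurableSet (A n) := fun n =>
    (measurable_walk hg n measurableSet_Icc).inter (measurableSet_weakAscent hg n)
  have hA_dep : ∀ n, DependsOn (· ∈ A n) (Set.Iio n) := fun n ω ω' h => by
    simp only [A, Set.mem_inter_iff, Set.mem_preimage, dependsOn_walk g n h,
      dependsOn_weakAscent n h]
  have hB : ∀ n, MeasurableSet (B n) := fun n =>
    (hA n).inter (measurableSet_le (by fun_prop) (by fun_prop))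
  have hlt : ∀ ω i j, ω ∈ B i → ω ∈ B j → j < i + k := by
    rintro ω i j ⟨⟨hi, -⟩, hik⟩ ⟨⟨hj, hmax⟩, -⟩
    by_contra! hle
    have := hmax _ hle
    simp only [Set.mem_preimage, Set.mem_Icc, Set.mem_ofPred_eq] at hi hj hik
    linarith
  rw [ENNReal.le_div_iff_mul_le (.inl hδk) (.inl (ENNReal.pow_ne_top (measure_ne_top _ _))),
    mul_comm, ← ENNReal.tsum_mul_left]
  calc ∑' n, δ ^ k * iidLaw m (A n) ≤ ∑' n, iidLaw m (B n) :=
        ENNReal.tsum_le_tsum fun n => pow_mul_iidLaw_le m hg n k (hA n) (hA_dep n) ε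
    _ ≤ k := by simpa using tsum_measure_le_of_forall_lt_add (iidLaw m) hB hlt

theorem exists_strictDescent_bound (hg : Measurable g) (hneg : 0 < m {e | g e < 0}) :
    ∃ C : ℝ≥0∞, C ≠ ∞ ∧ ∀ (b : ℝ) (N : ℕ),
      ∑' n : ℕ, iidLaw m (walk g n ⁻¹' Set.Icc b (b + N) ∩ strictDescent g n) ≤ C * (N + 1) := by
  obtain ⟨C, hC, hasc⟩ :=
    exists_weakAscent_bound m (g := fun e => -g e) hg.neg (by simpa using hneg)
  have hunit : ∀ b : ℝ,
      ∑' n : ℕ, iidLaw m (walk g n ⁻¹' Set.Icc b (b + 1) ∩ strictDescent g n) ≤ C := by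
    refine fun b => (ENNReal.tsum_le_tsum fun n => measure_mono ?_).trans (hasc (-b - 1))
    refine Set.inter_subset_inter (fun ω hω => ?_) (strictDescent_subset_weakAscent_neg n)
    rw [Set.mem_preimage, Set.mem_Icc, walk_neg]
    constructor <;> linarith [hω.1, hω.2]
  refine ⟨C, hC, fun b N => ?_⟩
  induction N with
  | zero =>
    refine (ENNReal.tsum_le_tsum fun n => measure_mono ?_).trans ((hunit b).trans (by simp))
    gcongr
    simp
  | succ N ih =>
    have hcover : Set.Icc b (b + (N + 1 : ℕ)) ⊆
        Set.Icc b (b + N) ∪ Set.Icc (b + N) (b + N + 1) := by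
      rw [Nat.cast_succ, ← add_assoc]
      exact Set.Icc_subset_Icc_union_Icc
    calc _ ≤ ∑' n : ℕ, (iidLaw m (walk g n ⁻¹' Set.Icc b (b + N) ∩ strictDescent g n) +
          iidLaw m (walk g n ⁻¹' Set.Icc (b + N) (b + N + 1) ∩ strictDescent g n)) :=
          ENNReal.tsum_le_tsum fun n => (measure_mono (by
            rw [← Set.union_inter_distrib_right, ← Set.preimage_union]
            gcongr)).trans (measure_union_le _ _)
      _ ≤ C * (N + 1) + C := by
          rw [ENNReal.tsum_add]
          exact add_le_add ih (hunit (b + N))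
      _ = C * ((N + 1 : ℕ) + 1) := by push_cast; ring

theorem exists_survival_zero_bound (hg : Measurable g) (hpos : 0 < m {e | 0 < g e}) :
    ∃ C : ℝ≥0∞, C ≠ ∞ ∧ ∀ b : ℝ,
      ∑' n : ℕ, iidLaw m (walk g n ⁻¹' Set.Icc b (b + 1) ∩ survival g 0 n) ≤ C := by
  obtain ⟨C, hC, hasc⟩ := exists_weakAscent_bound m hg hpos
  refine ⟨C, hC, fun b => (ENNReal.tsum_le_tsum fun n => ?_).trans (hasc b)⟩
  rw [survival_zero_eq_preimage_weakAscent, ← iidLaw_preimage_reversePrefix m n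
    ((measurable_walk hg n measurableSet_Icc).inter (measurableSet_weakAscent hg n))]
  refine measure_mono (Set.inter_subset_inter_left _ fun ω hω => ?_)
  change walk g n (reversePrefix n ω) ∈ Set.Icc b (b + 1)
  rwa [walk_reversePrefix g le_rfl, Nat.sub_self, walk_zero, sub_zero]

end Ladder

section Green

open Finset.HasAntidiagonal (antidiagonal)

theorem tsum_sum_antidiagonal (u : ℕ × ℕ → ℝ≥0∞) :
    ∑' k, ∑ p ∈ antidiagonal k, u p = ∑' i, ∑' l, u (i, l) := by
  rw [← ENNReal.tsum_prod, ← Finset.HasAntidiagonal.sigmaAntidiagonalEquivProd.tsum_eq,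
    ENNReal.tsum_sigma']
  exact tsum_congr fun k => (Finset.tsum_subtype (antidiagonal k) u).symm

theorem exists_first_min (s : ℕ → ℝ) (k : ℕ) :
    ∃ i ≤ k, (∀ j ≤ k, s i ≤ s j) ∧ ∀ j < i, s i < s j := by
  classical
  have hex : ∃ i, i ≤ k ∧ ∀ j ≤ k, s i ≤ s j := by
    simpa [Nat.lt_succ_iff] using Finset.exists_min_image (Finset.range (k + 1)) s ⟨0, by simp⟩
  obtain ⟨hle, hmin⟩ := Nat.find_spec hex
  refine ⟨Nat.find hex, hle, hmin, fun j hj => ?_⟩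
  by_contra! hji
  exact Nat.find_min hex hj ⟨hj.le.trans hle, fun i hi => hji.trans (hmin i hi)⟩

variable {E : Type*} {g : E → ℝ}

/-- The pairs `(ω, ω')` for which the walk started at `x`, following `ω` for `i` steps and then
`ω'` for `l` steps, stays nonnegative, has its first minimum at time `i` and ends in
`[a, a + 1]`. -/
def firstMinEvent (g : E → ℝ) (x a : ℝ) (i l : ℕ) : Set ((ℕ → E) × (ℕ → E)) :=
  {p | p.1 ∈ walk g i ⁻¹' Set.Icc (-x) (a + 1 - x) ∩ strictDescent g i ∧
    walk g l p.2 - (a - x - walk g i p.1) ∈ Set.Icc 0 1 ∧ p.2 ∈ survival g 0 l}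

theorem dependsOn_firstMinEvent (x a : ℝ) (i l : ℕ) (ω' : ℕ → E) :
    DependsOn (fun ω => (ω, ω') ∈ firstMinEvent g x a i l) (Set.Iio i) := fun ω₁ ω₂ h => by
  simp only [firstMinEvent, Set.mem_ofPred_eq, Set.mem_inter_iff, Set.mem_preimage,
    dependsOn_walk g i h, dependsOn_strictDescent i h]

theorem survival_subset_iUnion_firstMinEvent (x a : ℝ) (k : ℕ) :
    (fun ω => x + walk g k ω) ⁻¹' Set.Icc a (a + 1) ∩ survival g x k ⊆
      ⋃ p ∈ antidiagonal k, {ω | (ω, shift p.1 ω) ∈ firstMinEvent g x a p.1 p.2} := by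
  rintro ω ⟨⟨ha, ha'⟩, hsurv⟩
  obtain ⟨i, hik, hmin, hfirst⟩ := exists_first_min (fun j => walk g j ω) k
  obtain ⟨l, rfl⟩ := Nat.exists_eq_add_of_le hik
  have hshift : ∀ j ≤ l, 0 ≤ walk g j (shift i ω) := fun j hj => by
    linarith [hmin (i + j) (by omega), walk_add g i j ω]
  have hl := walk_add g i l ω
  refine Set.mem_biUnion (x := (i, l)) (by simp) ⟨⟨⟨?_, ?_⟩, hfirst⟩, ⟨?_, ?_⟩, fun j hj => ?_⟩
  · linarith [hsurv i hik]
  · linarith [hshift l le_rfl]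
  · linarith
  · linarith
  · linarith [hshift j hj]

variable [MeasurableSpace E]

theorem measurableSet_firstMinEvent (hg : Measurable g) (x a : ℝ) (i l : ℕ) :
    MeasurableSet (firstMinEvent g x a i l) :=
  (((measurable_walk hg i measurableSet_Icc).inter (measurableSet_strictDescent hg i)).preimage
    measurable_fst).inter
    ((measurableSet_Icc.preimage (by fun_prop)).inter
      ((measurableSet_survival hg 0 l).preimage measurable_snd))

variable (m : Measure E) [IsProbabilityMeasure m]

theorem tsum_iidLaw_firstMinEvent_le (hg : Measurable g) {C : ℝ≥0∞}
    (hC : ∀ b : ℝ, ∑' l : ℕ, iidLaw m (walk g l ⁻¹' Set.Icc b (b + 1) ∩ survival g 0 l) ≤ C)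
    (x a : ℝ) (i : ℕ) :
    ∑' l, iidLaw m {ω | (ω, shift i ω) ∈ firstMinEvent g x a i l} ≤
      C * iidLaw m (walk g i ⁻¹' Set.Icc (-x) (a + 1 - x) ∩ strictDescent g i) := by
  set L := walk g i ⁻¹' Set.Icc (-x) (a + 1 - x) ∩ strictDescent g i
  have hL : MeasurableSet L :=
    (measurable_walk hg i measurableSet_Icc).inter (measurableSet_strictDescent hg i)
  have hafter : ∀ ω, ∑' l, iidLaw m {ω' | (ω, ω') ∈ firstMinEvent g x a i l} ≤
      L.indicator (fun _ => C) ω := by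
    intro ω
    by_cases hω : ω ∈ L
    · rw [Set.indicator_of_mem hω]
      refine (ENNReal.tsum_le_tsum fun l => measure_mono ?_).trans (hC (a - x - walk g i ω))
      rintro ω' ⟨-, ⟨h_ge, h_le⟩, hω'⟩
      exact ⟨⟨by linarith, by linarith⟩, hω'⟩
    · have hempty : ∀ l, {ω' | (ω, ω') ∈ firstMinEvent g x a i l} = ∅ := fun l =>
        Set.eq_empty_of_forall_notMem fun ω' h => hω h.1
      simp [hempty]
  calc ∑' l, iidLaw m {ω | (ω, shift i ω) ∈ firstMinEvent g x a i l}
      = ∑' l, ∫⁻ ω, iidLaw m {ω' | (ω, ω') ∈ firstMinEvent g x a i l} ∂iidLaw m :=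
        tsum_congr fun l => iidLaw_setOf_shift m i (measurableSet_firstMinEvent hg x a i l)
          (dependsOn_firstMinEvent x a i l)
    _ = ∫⁻ ω, ∑' l, iidLaw m {ω' | (ω, ω') ∈ firstMinEvent g x a i l} ∂iidLaw m :=
        (lintegral_tsum fun l => (measurable_measure_prodMk_left
          (measurableSet_firstMinEvent hg x a i l)).aemeasurable).symm
    _ ≤ ∫⁻ ω, L.indicator (fun _ => C) ω ∂iidLaw m := lintegral_mono hafter
    _ = C * iidLaw m L := lintegral_indicator_const hL C

theorem exists_green_bound (hg : Measurable g) (hpos : 0 < m {e | 0 < g e}) :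
    ∃ C : ℝ≥0∞, C ≠ ∞ ∧ ∀ x a : ℝ,
      ∑' k : ℕ, iidLaw m ((fun ω => x + walk g k ω) ⁻¹' Set.Icc a (a + 1) ∩ survival g x k) ≤
        C * ∑' n : ℕ, iidLaw m (walk g n ⁻¹' Set.Icc (-x) (a + 1 - x) ∩ strictDescent g n) := by
  obtain ⟨C, hC, hsurv⟩ := exists_survival_zero_bound m hg hpos
  refine ⟨C, hC, fun x a => ?_⟩
  rw [← ENNReal.tsum_mul_left]
  calc _ ≤ ∑' k, ∑ p ∈ antidiagonal k,
          iidLaw m {ω | (ω, shift p.1 ω) ∈ firstMinEvent g x a p.1 p.2} :=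
        ENNReal.tsum_le_tsum fun k => (measure_mono
          (survival_subset_iUnion_firstMinEvent x a k)).trans (measure_biUnion_finset_le _ _)
    _ = ∑' i, ∑' l, iidLaw m {ω | (ω, shift i ω) ∈ firstMinEvent g x a i l} :=
        tsum_sum_antidiagonal fun p =>
          iidLaw m {ω | (ω, shift p.1 ω) ∈ firstMinEvent g x a p.1 p.2}
    _ ≤ _ := ENNReal.tsum_le_tsum fun i => tsum_iidLaw_firstMinEvent_le m hg hsurv x a i

end Green

section Renewal

variable {E : Type*} {g : E → ℝ}

/-- The event that the walk is negative at the times `1, …, n`. -/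
def negativeUpTo (g : E → ℝ) (n : ℕ) : Set (ℕ → E) :=
  {ω | ∀ j, 1 ≤ j → j ≤ n → walk g j ω < 0}

theorem dependsOn_negativeUpTo (n : ℕ) : DependsOn (· ∈ negativeUpTo g n) (Set.Iio n) :=
  fun ω ω' h => by
    simp +contextual only [negativeUpTo, Set.mem_ofPred_eq, walk_congr g _ h]

theorem negativeUpTo_eq_preimage_strictDescent (n : ℕ) :
    negativeUpTo g n = reversePrefix n ⁻¹' strictDescent g n := by
  ext ω
  simp only [Set.mem_preimage, Set.mem_ofPred_eq, strictDescent, negativeUpTo,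
    walk_reversePrefix g le_rfl, Nat.sub_self, walk_zero, sub_zero]
  constructor
  · intro h j hj
    rw [walk_reversePrefix g hj.le]
    linarith [h (n - j) (by omega) (by omega)]
  · intro h j h_one h_le
    have hrev := h (n - j) (by omega)
    rw [walk_reversePrefix g (Nat.sub_le n j), Nat.sub_sub_self h_le] at hrev
    linarith

theorem mem_negativeUpTo_succ {n : ℕ} {ω : ℕ → E} :
    ω ∈ negativeUpTo g (n + 1) ↔ ω ∈ negativeUpTo g n ∧ walk g (n + 1) ω < 0 := by
  refine ⟨fun h => ⟨fun j h_one h_le => h j h_one (by omega), h (n + 1) (by omega) le_rfl⟩, ?_⟩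
  rintro ⟨h, hn⟩ j h_one h_le
  rcases h_le.lt_or_eq with h_lt | rfl
  exacts [h j h_one (by omega), hn]

variable [MeasurableSpace E] (m : Measure E)

/-- The renewal function of the strictly descending ladder heights of the walk with i.i.d. steps
of law `m.map g`. -/
def descRenewal (g : E → ℝ) (x : ℝ) : ℝ≥0∞ :=
  ∑' n : ℕ, iidLaw m (walk g n ⁻¹' Set.Ici (-x) ∩ strictDescent g n)

theorem descRenewal_mono : Monotone (descRenewal m g) := fun x y hxy => by
  unfold descRenewal
  gcongr

theorem descRenewal_of_neg {x : ℝ} (hx : x < 0) : descRenewal m g x = 0 := by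
  refine ENNReal.tsum_eq_zero.2 fun n => measure_mono_null ?_ measure_empty
  rintro ω ⟨h_ge, hω⟩
  rw [Set.mem_preimage, Set.mem_Ici] at h_ge
  linarith [walk_le_zero_of_mem_strictDescent hω]

theorem measurableSet_negativeUpTo (hg : Measurable g) (n : ℕ) :
    MeasurableSet (negativeUpTo g n) := by
  simp only [negativeUpTo, measurableSet_setOfPred]; fun_prop

/-- The event that the walk, negative at the times `1, …, n`, is nonnegative at time `n + 1`. -/
def firstReturn (g : E → ℝ) (n : ℕ) : Set (ℕ → E) :=
  walk g (n + 1) ⁻¹' Set.Ici 0 ∩ negativeUpTo g n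

theorem measurableSet_firstReturn (hg : Measurable g) (n : ℕ) :
    MeasurableSet (firstReturn g n) :=
  (measurable_walk hg _ measurableSet_Ici).inter (measurableSet_negativeUpTo hg n)

theorem iidLaw_walk_succ_inter_negativeUpTo (hg : Measurable g) {y : ℝ} (hy : 0 ≤ y) (n : ℕ) :
    iidLaw m (walk g (n + 1) ⁻¹' Set.Ici (-y) ∩ negativeUpTo g n) =
      iidLaw m (walk g (n + 1) ⁻¹' Set.Ici (-y) ∩ negativeUpTo g (n + 1)) +
        iidLaw m (firstReturn g n) := by
  rw [← measure_union (Set.disjoint_left.2 fun ω h hret =>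
    (mem_negativeUpTo_succ.1 h.2).2.not_ge hret.1) (measurableSet_firstReturn hg n)]
  congr 1
  ext ω
  simp only [firstReturn, Set.mem_union, Set.mem_inter_iff, mem_negativeUpTo_succ,
    Set.mem_preimage, Set.mem_Ici]
  grind

variable [IsProbabilityMeasure m]

theorem exists_descRenewal_bound (hg : Measurable g) (hneg : 0 < m {e | g e < 0}) :
    ∃ C : ℝ≥0∞, C ≠ ∞ ∧ ∀ N : ℕ, descRenewal m g N ≤ C * (N + 1) := by
  obtain ⟨C, hC, hwindow⟩ := exists_strictDescent_bound m hg hneg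
  refine ⟨C, hC, fun N => (ENNReal.tsum_le_tsum fun n => measure_mono ?_).trans (hwindow (-N) N)⟩
  rintro ω ⟨h_ge, hω⟩
  exact ⟨⟨h_ge, by simpa using walk_le_zero_of_mem_strictDescent hω⟩, hω⟩

theorem one_le_descRenewal {x : ℝ} (hx : 0 ≤ x) : 1 ≤ descRenewal m g x := by
  refine le_trans ?_ (ENNReal.le_tsum 0)
  simp [strictDescent, Set.preimage, hx]

theorem descRenewal_ne_top (hg : Measurable g) (hneg : 0 < m {e | g e < 0}) (x : ℝ) :
    descRenewal m g x ≠ ∞ := by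
  obtain ⟨C, hC, hlin⟩ := exists_descRenewal_bound m hg hneg
  obtain ⟨N, hN⟩ := exists_nat_ge x
  refine ne_top_of_le_ne_top ?_ ((descRenewal_mono m hN).trans (hlin N))
  exact ENNReal.mul_ne_top hC (by simp)

theorem descRenewal_eq_tsum_negativeUpTo (hg : Measurable g) (x : ℝ) :
    descRenewal m g x = ∑' n : ℕ, iidLaw m (walk g n ⁻¹' Set.Ici (-x) ∩ negativeUpTo g n) := by
  refine tsum_congr fun n => ?_
  rw [negativeUpTo_eq_preimage_strictDescent, ← iidLaw_preimage_reversePrefix m n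
    ((measurable_walk hg n measurableSet_Ici).inter (measurableSet_strictDescent hg n)),
    Set.preimage_inter, ← Set.preimage_comp]
  congr 3
  ext ω
  simp [walk_reversePrefix g le_rfl]

theorem lintegral_descRenewal_eq_tsum (hg : Measurable g) (y : ℝ) :
    ∫⁻ e, descRenewal m g (y + g e) ∂m =
      ∑' n : ℕ, iidLaw m (walk g (n + 1) ⁻¹' Set.Ici (-y) ∩ negativeUpTo g n) := by
  set S : ℕ → Set ((ℕ → E) × E) := fun n =>
    {p | -(y + g p.2) ≤ walk g n p.1 ∧ p.1 ∈ negativeUpTo g n}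
  have hS : ∀ n, MeasurableSet (S n) := fun n =>
    (measurableSet_le (by fun_prop) ((measurable_walk hg n).comp measurable_fst)).inter
      (measurable_fst (measurableSet_negativeUpTo hg n))
  have hS_dep : ∀ n e, DependsOn (fun ω => (ω, e) ∈ S n) (Set.Iio n) := fun n e ω ω' h => by
    simp only [S, Set.mem_ofPred_eq, dependsOn_walk g n h, dependsOn_negativeUpTo n h]
  calc ∫⁻ e, descRenewal m g (y + g e) ∂m
      = ∫⁻ e, ∑' n, iidLaw m {ω | (ω, e) ∈ S n} ∂m :=
        lintegral_congr fun e => descRenewal_eq_tsum_negativeUpTo m hg _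
    _ = ∑' n, ∫⁻ e, iidLaw m {ω | (ω, e) ∈ S n} ∂m :=
        lintegral_tsum fun n => (measurable_measure_prodMk_right (hS n)).aemeasurable
    _ = ∑' n, iidLaw m {ω | (ω, ω n) ∈ S n} :=
        tsum_congr fun n => (iidLaw_setOf_next m n (hS n) (hS_dep n)).symm
    _ = _ := by
        refine tsum_congr fun n => congrArg _ (Set.ext fun ω => and_congr_left fun _ => ?_)
        rw [Set.mem_preimage, Set.mem_Ici, walk_succ]
        constructor <;> intro h <;> linarith

theorem tsum_firstReturn_le_one (hg : Measurable g) :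
    ∑' n, iidLaw m (firstReturn g n) ≤ 1 := by
  have hdisj : Pairwise (Function.onFun Disjoint (firstReturn g)) := by
    refine (pairwise_disjoint_on _).2 fun i j hij => Set.disjoint_left.2 fun ω hi hj => ?_
    exact (hj.2 (i + 1) (by omega) (by omega)).not_ge hi.1
  rw [← measure_iUnion hdisj (measurableSet_firstReturn hg)]
  exact prob_le_one

theorem lintegral_descRenewal_add_one (hg : Measurable g) {y : ℝ} (hy : 0 ≤ y) :
    ∫⁻ e, descRenewal m g (y + g e) ∂m + 1 =
      descRenewal m g y + ∑' n, iidLaw m (firstReturn g n) := by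
  have hzero : walk g 0 ⁻¹' Set.Ici (-y) ∩ negativeUpTo g 0 = Set.univ :=
    Set.eq_univ_of_forall fun ω => ⟨by simpa using hy, fun j h_one h_le => by omega⟩
  rw [lintegral_descRenewal_eq_tsum m hg, descRenewal_eq_tsum_negativeUpTo m hg,
    tsum_eq_zero_add' (f := fun n => iidLaw m (walk g n ⁻¹' Set.Ici (-y) ∩ negativeUpTo g n))
      ENNReal.summable, hzero, measure_univ, add_comm 1, add_right_comm,
    ← ENNReal.tsum_add]
  simp_rw [iidLaw_walk_succ_inter_negativeUpTo m hg hy]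

end Renewal

section Convex

variable {r : ℝ → ℝ}

/-- The primitive of `r` vanishing at `0`; it is convex when `r` is monotone. -/
def primitive (r : ℝ → ℝ) (t : ℝ) : ℝ := ∫ y in (0 : ℝ)..t, r y

theorem primitive_add_mul_le (hr : Monotone r) (a u : ℝ) :
    primitive r a + r a * u ≤ primitive r (a + u) := by
  suffices h : r a * u ≤ ∫ y in a..(a + u), r y by
    rw [primitive, primitive, ← intervalIntegral.integral_add_adjacent_intervals
      (hr.intervalIntegrable (a := 0) (b := a)) (hr.intervalIntegrable (b := a + u))]
    linarith
  rcases le_total 0 u with hu | hu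
  · have hle := intervalIntegral.integral_mono_on (by linarith : a ≤ a + u)
      (intervalIntegrable_const (μ := volume) (c := r a)) hr.intervalIntegrable fun y hy => hr hy.1
    simp only [intervalIntegral.integral_const, smul_eq_mul] at hle
    linarith
  · have hle := intervalIntegral.integral_mono_on (by linarith : a + u ≤ a)
      hr.intervalIntegrable (intervalIntegrable_const (μ := volume) (c := r a)) fun y hy => hr hy.2
    simp only [intervalIntegral.integral_const, smul_eq_mul] at hle
    rw [intervalIntegral.integral_symm]
    linarith

theorem primitive_add_le (hr : Monotone r) (a u : ℝ) :
    primitive r (a + u) ≤ primitive r a + r (a + u) * u := by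
  have h := primitive_add_mul_le hr (a + u) (-u)
  rw [add_neg_cancel_right] at h
  linarith

theorem primitive_zero : primitive r 0 = 0 := intervalIntegral.integral_same

theorem primitive_add_sub_primitive (hr : Monotone r) {t : ℝ} (ht : 0 ≤ t) (u : ℝ) :
    primitive r (t + u) - primitive r u = ∫ y in Set.Ioc 0 t, r (y + u) := by
  rw [primitive, primitive, intervalIntegral.integral_interval_sub_left hr.intervalIntegrable
    hr.intervalIntegrable, ← intervalIntegral.integral_of_le ht,
    intervalIntegral.integral_comp_add_right, zero_add]

theorem max_zero_le_primitive (hr : Monotone r) (h_neg : ∀ y < 0, r y = 0) (h_one : 1 ≤ r 0)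
    (u : ℝ) : max u 0 ≤ primitive r u := by
  rcases le_or_gt 0 u with hu | hu
  · have h := primitive_add_mul_le hr 0 u
    rw [primitive_zero, zero_add, zero_add] at h
    rw [max_eq_left hu]
    nlinarith
  · rw [max_eq_right hu.le, primitive, intervalIntegral.integral_symm,
      intervalIntegral.integral_of_le hu.le, integral_Ioc_eq_integral_Ioo,
      setIntegral_eq_zero_of_forall_eq_zero fun y hy => h_neg y hy.2, neg_zero]

variable {E : Type*} [MeasurableSpace E] {m : Measure E} {g : E → ℝ}

theorem tendsto_integral_monotone_add_mul {L : ℝ} (hr : Monotone r) (hL : ∀ y, |r y| ≤ L)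
    (hg : Measurable g) (hg_int : Integrable g m) :
    Tendsto (fun N : ℕ => ∫ e, r (N + g e) * g e ∂m) atTop (𝓝 ((⨆ y, r y) * ∫ e, g e ∂m)) := by
  rw [← integral_const_mul]
  refine tendsto_integral_of_dominated_convergence (fun e => L * |g e|)
    (fun N => ((hr.measurable.comp (hg.const_add _)).mul hg).aestronglyMeasurable)
    (hg_int.abs.const_mul L) (fun N => .of_forall fun e => ?_) (.of_forall fun e => ?_)
  · rw [Real.norm_eq_abs, abs_mul]
    gcongr
    exact hL _
  · refine Tendsto.mul_const _ ((tendsto_atTop_ciSup hr ?_).comp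
      (tendsto_atTop_add_const_right _ _ tendsto_natCast_atTop_atTop))
    exact ⟨L, Set.forall_mem_range.2 fun y => (le_abs_self _).trans (hL y)⟩

variable [IsProbabilityMeasure m]

theorem integrable_monotone_add (hr : Monotone r) {K : ℝ} (hK : ∀ y, |r y| ≤ K * (1 + |y|))
    (hg : Measurable g) (hg_int : Integrable g m) (t : ℝ) :
    Integrable (Function.uncurry fun (e : E) (y : ℝ) => r (y + g e))
      (m.prod (volume.restrict (Set.Ioc 0 t))) := by
  have hdom : Integrable (fun e => |K| * (1 + t + |g e|)) m :=
    ((integrable_const _).add hg_int.abs).const_mul _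
  have hmeas : Measurable fun z : E × ℝ => z.2 + g z.1 := by fun_prop
  have hmem : ∀ᵐ z ∂(m.prod (volume.restrict (Set.Ioc 0 t))), z.2 ∈ Set.Ioc 0 t :=
    Measure.quasiMeasurePreserving_snd.ae (ae_restrict_mem measurableSet_Ioc)
  refine (hdom.comp_fst (volume.restrict (Set.Ioc 0 t))).mono'
    (hr.measurable.comp hmeas).aestronglyMeasurable ?_
  filter_upwards [hmem] with z hz
  have habs : |z.2 + g z.1| ≤ t + |g z.1| := by
    refine (abs_add_le _ _).trans ?_
    rw [abs_of_pos hz.1]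
    linarith [hz.2]
  calc |r (z.2 + g z.1)| ≤ K * (1 + |z.2 + g z.1|) := hK _
    _ ≤ |K| * (1 + |z.2 + g z.1|) := by gcongr; exact le_abs_self K
    _ ≤ |K| * (1 + t + |g z.1|) := by gcongr _ * ?_; linarith

theorem integrable_primitive_add_sub (hr : Monotone r) {K : ℝ} (hK : ∀ y, |r y| ≤ K * (1 + |y|))
    (hg : Measurable g) (hg_int : Integrable g m) {t : ℝ} (ht : 0 ≤ t) :
    Integrable (fun e => primitive r (t + g e) - primitive r (g e)) m := by
  simp only [primitive_add_sub_primitive hr ht]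
  exact (integrable_monotone_add hr hK hg hg_int t).integral_prod_left

theorem integral_primitive_add_sub (hr : Monotone r) {K : ℝ} (hK : ∀ y, |r y| ≤ K * (1 + |y|))
    (hg : Measurable g) (hg_int : Integrable g m) {p : ℝ}
    (hp : ∀ y, 0 ≤ y → ∫ e, r (y + g e) ∂m = r y - p) {t : ℝ} (ht : 0 ≤ t) :
    ∫ e, (primitive r (t + g e) - primitive r (g e)) ∂m = primitive r t - p * t := by
  simp only [primitive_add_sub_primitive hr ht]
  rw [integral_integral_swap (integrable_monotone_add hr hK hg hg_int t),
    setIntegral_congr_fun measurableSet_Ioc fun y hy => hp y hy.1.le,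
    ← intervalIntegral.integral_of_le ht, intervalIntegral.integral_sub hr.intervalIntegrable
      intervalIntegrable_const]
  simp [primitive, mul_comm]

/- Integrate the equation over `[0, N]`: convexity of the primitive and `E g = 0` bound `p * N` by a
quantity that does not depend on `N`. -/
theorem nonpos_of_harmonic_defect (hr : Monotone r) {K : ℝ} (hK : ∀ y, |r y| ≤ K * (1 + |y|))
    (hg : Measurable g) (hg_int : Integrable g m) (hg_sq : Integrable (fun e => g e ^ 2) m)
    (hg_zero : ∫ e, g e ∂m = 0) {p : ℝ}
    (hp : ∀ y, 0 ≤ y → ∫ e, r (y + g e) ∂m = r y - p) : p ≤ 0 := by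
  set b : E → ℝ := fun e => K * (|g e| + g e ^ 2)
  have hb : Integrable b m := (hg_int.abs.add hg_sq).const_mul K
  have hprim : ∀ e, primitive r (g e) ≤ b e := fun e => by
    have h := primitive_add_le hr 0 (g e)
    rw [zero_add, primitive_zero, zero_add] at h
    calc primitive r (g e) ≤ |r (g e)| * |g e| := h.trans ((le_abs_self _).trans (abs_mul _ _).le)
      _ ≤ K * (1 + |g e|) * |g e| := by gcongr; exact hK _
      _ = b e := by simp only [b]; rw [← sq_abs (g e)]; ring
  have hbound : ∀ N : ℕ, p * N ≤ ∫ e, b e ∂m := fun N => by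
    have hlin : Integrable (fun e => primitive r N + r N * g e) m :=
      (integrable_const _).add (hg_int.const_mul _)
    have hle : ∫ e, (primitive r N + r N * g e - b e) ∂m ≤ primitive r N - p * N := by
      rw [← integral_primitive_add_sub hr hK hg hg_int hp N.cast_nonneg]
      refine integral_mono (hlin.sub hb)
        (integrable_primitive_add_sub hr hK hg hg_int N.cast_nonneg) fun e => ?_
      linarith [primitive_add_mul_le hr N (g e), hprim e]
    rw [integral_sub hlin hb, integral_add (integrable_const _) (hg_int.const_mul _),
      integral_const_mul, hg_zero] at hle
    simp only [integral_const, probReal_univ, one_smul, mul_zero, add_zero] at hle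
    linarith
  by_contra! hpos
  obtain ⟨N, hN⟩ := exists_nat_gt ((∫ e, b e ∂m) / p)
  rw [div_lt_iff₀ hpos] at hN
  linarith [hbound N]

/- If `r` were bounded, integrating harmonicity over `[0, N]` and letting `N → ∞` would give
`E g⁺ ≤ (sup r) * E g = 0`. -/
theorem not_bounded_of_harmonic (hr : Monotone r) (h_neg : ∀ y < 0, r y = 0) (h_one : 1 ≤ r 0)
    (hg : Measurable g) (hg_int : Integrable g m) (hg_zero : ∫ e, g e ∂m = 0)
    (hg_pos : 0 < m {e | 0 < g e})
    (hharm : ∀ y, 0 ≤ y → ∫ e, r (y + g e) ∂m = r y) : ¬ BddAbove (Set.range r) := by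
  rintro ⟨L, hL⟩
  have h_nonneg : ∀ y, 0 ≤ r y := fun y =>
    (h_neg _ (by linarith [min_le_right y 0])).ge.trans
      (hr (show min y 0 - 1 ≤ y by linarith [min_le_left y 0]))
  have h_abs : ∀ y, |r y| ≤ L := fun y => (abs_of_nonneg (h_nonneg y)).trans_le (hL ⟨y, rfl⟩)
  have hK : ∀ y, |r y| ≤ L * (1 + |y|) := fun y =>
    (h_abs y).trans (le_mul_of_one_le_right ((abs_nonneg _).trans (h_abs y)) (by simp))
  have hmax : Integrable (fun e => max (g e) 0) m := hg_int.pos_part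
  have hmul : ∀ N : ℕ, Integrable (fun e => r (N + g e) * g e) m := fun N =>
    hg_int.bdd_mul (hr.measurable.comp (hg.const_add _)).aestronglyMeasurable
      (.of_forall fun e => h_abs _)
  have hle : ∀ N : ℕ, ∫ e, max (g e) 0 ∂m ≤ ∫ e, r (N + g e) * g e ∂m := fun N => by
    have hmono := integral_mono
      (integrable_primitive_add_sub hr hK hg hg_int N.cast_nonneg)
      (((integrable_const (primitive r N)).add (hmul N)).sub hmax) fun e =>
        sub_le_sub (primitive_add_le hr N (g e)) (max_zero_le_primitive hr h_neg h_one (g e))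
    rw [integral_primitive_add_sub hr hK hg hg_int (p := 0) (by simpa using hharm) N.cast_nonneg,
      integral_sub' ((integrable_const _).add (hmul N)) hmax,
      integral_add' (integrable_const _) (hmul N)] at hmono
    simp only [integral_const, probReal_univ, one_smul, zero_mul, sub_zero] at hmono
    linarith
  have hzero : ∫ e, max (g e) 0 ∂m = 0 := by
    refine le_antisymm ?_ (integral_nonneg fun e => le_max_right _ _)
    simpa [hg_zero] using ge_of_tendsto' (tendsto_integral_monotone_add_mul hr h_abs hg hg_int) hle
  have hae : (fun e => max (g e) 0) =ᵐ[m] 0 :=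
    (integral_eq_zero_iff_of_nonneg (fun e => le_max_right (g e) 0) hmax).1 hzero
  refine hg_pos.ne' (measure_mono_null (fun e he => ?_) hae)
  simpa using he

end Convex

section Centered

variable {E : Type*} [MeasurableSpace E] {m : Measure E} {g : E → ℝ}

/-- `g` is, under `m`, the step of a non-degenerate centered random walk with finite variance. -/
structure IsCenteredStep (m : Measure E) (g : E → ℝ) : Prop where
  measurable : Measurable g
  integrable : Integrable g m
  integrable_sq : Integrable (fun e => g e ^ 2) m
  integral_eq_zero : ∫ e, g e ∂m = 0
  pos : 0 < m {e | 0 < g e}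
  neg : 0 < m {e | g e < 0}

theorem measurable_descRenewal : Measurable (descRenewal m g) := (descRenewal_mono m).measurable

variable [IsProbabilityMeasure m]

theorem exists_toReal_descRenewal_bound (h : IsCenteredStep m g) :
    ∃ K : ℝ, ∀ y, |(descRenewal m g y).toReal| ≤ K * (1 + |y|) := by
  obtain ⟨C, hC, hlin⟩ := exists_descRenewal_bound m h.measurable h.neg
  refine ⟨2 * C.toReal, fun y => ?_⟩
  have hle : descRenewal m g y ≤ C * (⌈|y|⌉₊ + 1) :=
    (descRenewal_mono m ((le_abs_self y).trans (Nat.le_ceil _))).trans (hlin _)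
  have hle_real := ENNReal.toReal_mono (ENNReal.mul_ne_top hC (by simp)) hle
  rw [ENNReal.toReal_mul, ENNReal.toReal_add (by simp) (by simp), ENNReal.toReal_natCast,
    ENNReal.toReal_one] at hle_real
  rw [abs_of_nonneg ENNReal.toReal_nonneg]
  have hceil := Nat.ceil_lt_add_one (abs_nonneg y)
  nlinarith [abs_nonneg y, ENNReal.toReal_nonneg (a := C)]

theorem toReal_descRenewal_mono (h : IsCenteredStep m g) :
    Monotone fun y => (descRenewal m g y).toReal := fun _ y hxy =>
  ENNReal.toReal_mono (descRenewal_ne_top m h.measurable h.neg y) (descRenewal_mono m hxy)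

theorem integral_toReal_descRenewal_add (h : IsCenteredStep m g) (y : ℝ) :
    ∫ e, (descRenewal m g (y + g e)).toReal ∂m =
      (∫⁻ e, descRenewal m g (y + g e) ∂m).toReal :=
  integral_toReal (measurable_descRenewal.comp (h.measurable.const_add y)).aemeasurable
    (.of_forall fun _ => (descRenewal_ne_top m h.measurable h.neg _).lt_top)

theorem tsum_firstReturn_eq_one (h : IsCenteredStep m g) :
    ∑' n, iidLaw m (firstReturn g n) = 1 := by
  set q := ∑' n, iidLaw m (firstReturn g n)
  have hq_le : q ≤ 1 := tsum_firstReturn_le_one m h.measurable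
  have hq_ne_top : q ≠ ∞ := ne_top_of_le_ne_top ENNReal.one_ne_top hq_le
  have hdefect : ∀ y, 0 ≤ y → ∫ e, (descRenewal m g (y + g e)).toReal ∂m =
      (descRenewal m g y).toReal - (1 - q.toReal) := fun y hy => by
    have heq := lintegral_descRenewal_add_one m h.measurable hy
    have hfin := descRenewal_ne_top m h.measurable h.neg y
    have hint : ∫⁻ e, descRenewal m g (y + g e) ∂m ≠ ∞ :=
      ne_top_of_le_ne_top (ENNReal.add_ne_top.2 ⟨hfin, hq_ne_top⟩) (le_self_add.trans heq.le)
    have heq_real := congrArg ENNReal.toReal heq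
    rw [ENNReal.toReal_add hint ENNReal.one_ne_top, ENNReal.toReal_add hfin hq_ne_top,
      ENNReal.toReal_one] at heq_real
    rw [integral_toReal_descRenewal_add h]
    linarith
  obtain ⟨K, hK⟩ := exists_toReal_descRenewal_bound h
  have hp := nonpos_of_harmonic_defect (toReal_descRenewal_mono h) hK h.measurable h.integrable
    h.integrable_sq h.integral_eq_zero hdefect
  refine hq_le.antisymm ?_
  rw [← ENNReal.toReal_le_toReal ENNReal.one_ne_top hq_ne_top, ENNReal.toReal_one]
  linarith

/- Since `descRenewal m g` vanishes on the negative half-line, this says that it is harmonic for the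
walk killed when it becomes negative. -/
theorem lintegral_descRenewal (h : IsCenteredStep m g) {y : ℝ} (hy : 0 ≤ y) :
    ∫⁻ e, descRenewal m g (y + g e) ∂m = descRenewal m g y := by
  have heq := lintegral_descRenewal_add_one m h.measurable hy
  rw [tsum_firstReturn_eq_one h] at heq
  exact (ENNReal.add_left_inj ENNReal.one_ne_top).1 heq

theorem tendsto_descRenewal (h : IsCenteredStep m g) :
    Tendsto (descRenewal m g) atTop (𝓝 ∞) := by
  have hfin := descRenewal_ne_top m h.measurable h.neg
  have hunbdd := not_bounded_of_harmonic (toReal_descRenewal_mono h)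
    (fun y hy => by simp [descRenewal_of_neg m hy])
    (by simpa using ENNReal.toReal_mono (hfin 0) (one_le_descRenewal m le_rfl))
    h.measurable h.integrable h.integral_eq_zero h.pos
    (fun y hy => by rw [integral_toReal_descRenewal_add h, lintegral_descRenewal h hy])
  rw [ENNReal.tendsto_nhds_top_iff_nat]
  intro N
  obtain ⟨_, ⟨x, rfl⟩, hx⟩ := not_bddAbove_iff.1 hunbdd N
  filter_upwards [eventually_ge_atTop x] with y hy
  refine lt_of_lt_of_le ?_ (descRenewal_mono m hy)
  rw [← ENNReal.toReal_lt_toReal (by simp) (hfin x)]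
  simpa using hx

end Centered

section SpineStep

/-- The displacement of the child that continues the spine. -/
def displacement (e : Offspring × ℕ) : ℝ := (e.1 e.2).untopD 0

theorem measurable_offspring_apply : Measurable fun e : Offspring × ℕ => e.1 e.2 :=
  measurable_from_prod_countable_left fun i => measurable_pi_apply i

theorem measurable_displacement : Measurable displacement :=
  (by fun_prop : Measurable fun a : WithTop ℝ => a.untopD 0).comp measurable_offspring_apply

variable {Θ : Measure Offspring}

theorem lintegral_spineStep (hfin : ∫⁻ θ, ∑' i, weight (θ i) ∂Θ ≠ ∞) {H : Offspring × ℕ → ℝ≥0∞}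
    (hH : Measurable H) :
    ∫⁻ e, H e ∂spineStep Θ = ∫⁻ θ, ∑' i, weight (θ i) * H (θ, i) ∂Θ := by
  have hw : ∀ i : ℕ, Measurable fun θ : Offspring => weight (θ i) :=
    fun i => measurable_weight.comp (measurable_pi_apply i)
  have hratio : ∀ i : ℕ, Measurable fun θ : Offspring => weight (θ i) / ∑' j, weight (θ j) :=
    fun i => (hw i).div measurable_weight_sum
  have hpair : ∀ i : ℕ, Measurable fun θ : Offspring => (θ, i) := fun i => by fun_prop
  have hH_pair : ∀ i : ℕ, Measurable fun θ : Offspring => H (θ, i) := fun i => hH.comp (hpair i)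
  rw [spineStep, lintegral_sum_measure, lintegral_tsum (f := fun i θ => weight (θ i) * H (θ, i))
    fun i => ((hw i).mul (hH_pair i)).aemeasurable]
  refine tsum_congr fun i => ?_
  rw [lintegral_map hH (hpair i), lintegral_withDensity_eq_lintegral_mul _ (hratio i) (hH_pair i),
    sizeBiased, lintegral_withDensity_eq_lintegral_mul _ measurable_weight_sum
      ((hratio i).mul (hH_pair i))]
  refine lintegral_congr_ae ?_
  filter_upwards [ae_lt_top measurable_weight_sum hfin] with θ hθ
  simp only [Pi.mul_apply, ← mul_assoc]
  congr 1
  by_cases h_zero : ∑' j, weight (θ j) = 0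
  · simp [h_zero, ENNReal.tsum_eq_zero.1 h_zero i]
  · exact ENNReal.mul_div_cancel h_zero hθ.ne

theorem ae_spineStep_ne_top (hfin : ∫⁻ θ, ∑' i, weight (θ i) ∂Θ ≠ ∞) :
    ∀ᵐ e ∂spineStep Θ, e.1 e.2 ≠ ⊤ := by
  set S : Set (Offspring × ℕ) := {e | e.1 e.2 = ⊤}
  have hS : MeasurableSet S := measurable_offspring_apply (measurableSet_singleton _)
  have hweight : ∀ (θ : Offspring) (i : ℕ), weight (θ i) * S.indicator 1 (θ, i) = 0 := fun θ i => by
    by_cases h : θ i = ⊤ <;> simp [S, h, weight]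
  have hnull : spineStep Θ S = 0 := by
    rw [← lintegral_indicator_one hS, lintegral_spineStep hfin (measurable_one.indicator hS)]
    simp [hweight]
  rw [ae_iff]
  simpa only [ne_eq, not_not] using hnull

theorem weight_mul_ofReal_sq (a : WithTop ℝ) :
    weight a * ENNReal.ofReal (a.untopD 0 ^ 2) = sqWeight a := by
  induction a using WithTop.recTopCoe with
  | top => simp [weight, sqWeight]
  | coe r =>
    simp only [weight, sqWeight, WithTop.recTopCoe_coe, WithTop.untopD_coe]
    rw [← ENNReal.ofReal_mul (Real.exp_nonneg _), mul_comm]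

theorem weight_mul_ofReal (a : WithTop ℝ) :
    weight a * ENNReal.ofReal (a.untopD 0) = ENNReal.ofReal (linWeight a) := by
  induction a using WithTop.recTopCoe with
  | top => simp [weight, linWeight]
  | coe r =>
    simp only [weight, linWeight, WithTop.recTopCoe_coe, WithTop.untopD_coe]
    rw [← ENNReal.ofReal_mul (Real.exp_nonneg _), mul_comm]

theorem weight_mul_ofReal_neg (a : WithTop ℝ) :
    weight a * ENNReal.ofReal (-a.untopD 0) = ENNReal.ofReal (-linWeight a) := by
  induction a using WithTop.recTopCoe with
  | top => simp [weight, linWeight]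
  | coe r =>
    simp only [weight, linWeight, WithTop.recTopCoe_coe, WithTop.untopD_coe]
    rw [← ENNReal.ofReal_mul (Real.exp_nonneg _), mul_comm, neg_mul]

theorem measurable_linWeight : Measurable linWeight :=
  WithTop.measurable_of_measurable_comp_coe (by
    simp only [linWeight, WithTop.recTopCoe_coe]; fun_prop)

theorem tsum_eq_toReal_sub_toReal {ι : Type*} {a : ι → ℝ}
    (hpos : ∑' i, ENNReal.ofReal (a i) ≠ ∞) (hneg : ∑' i, ENNReal.ofReal (-a i) ≠ ∞) :
    ∑' i, a i = (∑' i, ENNReal.ofReal (a i)).toReal - (∑' i, ENNReal.ofReal (-a i)).toReal := by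
  rw [ENNReal.tsum_toReal_eq fun i => ENNReal.ofReal_ne_top,
    ENNReal.tsum_toReal_eq fun i => ENNReal.ofReal_ne_top,
    ← (ENNReal.summable_toReal hpos).tsum_sub (ENNReal.summable_toReal hneg)]
  simp only [ENNReal.toReal_ofReal', max_zero_sub_max_neg_zero_eq_self]

theorem integral_displacement (hfin : ∫⁻ θ, ∑' i, weight (θ i) ∂Θ ≠ ∞)
    (hint : Integrable displacement (spineStep Θ)) :
    ∫ e, displacement e ∂spineStep Θ = ∫ θ, ∑' i, linWeight (θ i) ∂Θ := by
  have hpos := lintegral_spineStep hfin measurable_displacement.ennreal_ofReal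
  have hneg := lintegral_spineStep hfin measurable_displacement.neg.ennreal_ofReal
  simp only [displacement, Pi.neg_apply, weight_mul_ofReal, weight_mul_ofReal_neg] at hpos hneg
  have hpos_fin := hpos ▸ hint.lintegral_lt_top.ne
  have hneg_fin := hneg ▸ hint.neg.lintegral_lt_top.ne
  have hlin : ∀ i : ℕ, Measurable fun θ : Offspring => linWeight (θ i) :=
    fun i => measurable_linWeight.comp (measurable_pi_apply i)
  have hpos_meas : Measurable fun θ : Offspring => ∑' i, ENNReal.ofReal (linWeight (θ i)) :=
    Measurable.tsum fun i => (hlin i).ennreal_ofReal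
  have hneg_meas : Measurable fun θ : Offspring => ∑' i, ENNReal.ofReal (-linWeight (θ i)) :=
    Measurable.tsum fun i => (hlin i).neg.ennreal_ofReal
  have hpos_ae := ae_lt_top hpos_meas hpos_fin
  have hneg_ae := ae_lt_top hneg_meas hneg_fin
  rw [integral_eq_lintegral_pos_part_sub_lintegral_neg_part hint]
  simp only [displacement]
  rw [hpos, hneg, ← integral_toReal hpos_meas.aemeasurable hpos_ae,
    ← integral_toReal hneg_meas.aemeasurable hneg_ae,
    ← integral_sub (integrable_toReal_of_lintegral_ne_top hpos_meas.aemeasurable hpos_fin)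
      (integrable_toReal_of_lintegral_ne_top hneg_meas.aemeasurable hneg_fin)]
  refine integral_congr_ae ?_
  filter_upwards [hpos_ae, hneg_ae] with θ hpos_θ hneg_θ
  exact (tsum_eq_toReal_sub_toReal hpos_θ.ne hneg_θ.ne).symm

theorem lintegral_displacement_sq (hfin : ∫⁻ θ, ∑' i, weight (θ i) ∂Θ ≠ ∞) :
    ∫⁻ e, ENNReal.ofReal (displacement e ^ 2) ∂spineStep Θ =
      ∫⁻ θ, ∑' i, sqWeight (θ i) ∂Θ := by
  rw [lintegral_spineStep hfin (measurable_displacement.pow_const 2).ennreal_ofReal]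
  simp only [displacement, weight_mul_ofReal_sq]

theorem measure_setOf_pos_pos_of_integral_eq_zero {E : Type*} [MeasurableSpace E] {m : Measure E}
    {g : E → ℝ} (hint : Integrable g m) (hzero : ∫ e, g e ∂m = 0) (hne : ¬ g =ᵐ[m] 0) :
    0 < m {e | 0 < g e} := by
  refine pos_iff_ne_zero.2 fun hnull => hne ?_
  have hle : ∀ᵐ e ∂m, 0 ≤ -g e := by
    simpa only [ae_iff, not_le, Left.neg_neg_iff] using hnull
  have hneg : (fun e => -g e) =ᵐ[m] 0 :=
    (integral_eq_zero_iff_of_nonneg_ae hle hint.neg).1 (by rw [integral_neg, hzero, neg_zero])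
  filter_upwards [hneg] with e he
  exact neg_eq_zero.1 he

theorem IsBoundaryCase.lintegral_weight_ne_top (hΘ : IsBoundaryCase Θ) :
    ∫⁻ θ, ∑' i, weight (θ i) ∂Θ ≠ ∞ :=
  hΘ.total_weight ▸ ENNReal.one_ne_top

theorem IsBoundaryCase.integrable_displacement_sq (hΘ : IsBoundaryCase Θ) :
    Integrable (fun e => displacement e ^ 2) (spineStep Θ) := by
  refine ⟨(measurable_displacement.pow_const 2).aestronglyMeasurable, ?_⟩
  rw [hasFiniteIntegral_iff_ofReal (.of_forall fun e => sq_nonneg _),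
    lintegral_displacement_sq hΘ.lintegral_weight_ne_top]
  exact hΘ.variance_lt_top

theorem IsBoundaryCase.not_displacement_ae_eq_zero (hΘ : IsBoundaryCase Θ) :
    ¬ displacement =ᵐ[spineStep Θ] 0 := fun h => by
  refine hΘ.variance_pos.ne' ?_
  rw [← lintegral_displacement_sq hΘ.lintegral_weight_ne_top,
    lintegral_congr_ae (g := 0) (by filter_upwards [h] with e he; simp [he])]
  exact lintegral_zero

theorem IsBoundaryCase.isCenteredStep_displacement (hΘ : IsBoundaryCase Θ) :
    IsCenteredStep (spineStep Θ) displacement := by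
  have := isProbabilityMeasure_spineStep hΘ
  have hint : Integrable displacement (spineStep Θ) :=
    ((memLp_two_iff_integrable_sq measurable_displacement.aestronglyMeasurable).2
      hΘ.integrable_displacement_sq).integrable one_le_two
  have hzero : ∫ e, displacement e ∂spineStep Θ = 0 :=
    (integral_displacement hΘ.lintegral_weight_ne_top hint).trans hΘ.mean
  have hne := hΘ.not_displacement_ae_eq_zero
  refine ⟨measurable_displacement, hint, hΘ.integrable_displacement_sq, hzero,
    measure_setOf_pos_pos_of_integral_eq_zero hint hzero hne, ?_⟩
  have hneg := measure_setOf_pos_pos_of_integral_eq_zero hint.neg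
    (by simp [integral_neg, hzero]) fun h => hne (by simpa using h.neg)
  simpa using hneg

end SpineStep

section SpinePosition

theorem length_rayVertex (r : ℕ → ℕ) (n : ℕ) : (rayVertex r n).length = n := by
  induction n with
  | zero => rfl
  | succ n ih => rw [rayVertex, List.length_cons, ih]

theorem measurable_sigmaUpTo_spinePos {k n : ℕ} (hk : k ≤ n) :
    Measurable[sigmaUpTo n] (spinePos k) := by
  intro B hB
  have hunion : spinePos k ⁻¹' B = ⋃ u : Vertex, ⋃ _ : u.length ≤ n, spine k ⁻¹' {u} ∩
      (fun ω : Path => ω.1 u) ⁻¹' ((fun a : WithTop ℝ => a.untopD 0) ⁻¹' B) := by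
    ext ω
    simp only [Set.mem_preimage, Set.mem_iUnion, Set.mem_inter_iff, Set.mem_singleton_iff,
      exists_prop, spinePos]
    constructor
    · exact fun h => ⟨spine k ω, by rwa [spine, length_rayVertex], rfl, h⟩
    · rintro ⟨u, -, rfl, h⟩
      exact h
  rw [hunion]
  refine MeasurableSet.iUnion fun u => MeasurableSet.iUnion fun hu => MeasurableSet.inter ?_ ?_
  · exact (le_sup_of_le_right (le_iSup₂_of_le k hk le_rfl) :
      MeasurableSpace.comap (spine k) ⊤ ≤ sigmaUpTo n) _ ⟨{u}, trivial, rfl⟩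
  · exact (le_sup_of_le_left (le_iSup₂_of_le u hu le_rfl) :
      MeasurableSpace.comap (fun ω : Path => ω.1 u) inferInstance ≤ sigmaUpTo n) _
        ⟨_, (by fun_prop : Measurable fun a : WithTop ℝ => a.untopD 0) hB, rfl⟩

theorem sigmaUpTo_le (n : ℕ) : sigmaUpTo n ≤ (inferInstance : MeasurableSpace Path) := by
  refine sup_le (iSup₂_le fun u _ => ?_) (iSup₂_le fun k _ => ?_)
  · exact Measurable.comap_le (by fun_prop)
  · rintro _ ⟨B, -, rfl⟩
    have hunion : spine k ⁻¹' B = ⋃ u ∈ B, {ω : Path | u = rayVertex ω.2 k} := by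
      ext ω; simp [spine]
    rw [hunion]
    exact MeasurableSet.biUnion (Set.to_countable _) fun u _ =>
      measurable_snd (measurableSet_rayVertex_eq k u)

theorem measurable_spinePos (k : ℕ) : Measurable (spinePos k) :=
  (measurable_sigmaUpTo_spinePos le_rfl).mono (sigmaUpTo_le k) le_rfl

/-- The point of the canonical space that a realization of the noise produces, so that `P*_x` is the
law of `noisePath x`. -/
def noisePath (x : ℝ) (ν : Noise) : Path := (noisePosition x ν, noiseRay ν)

theorem measurable_noisePath (x : ℝ) : Measurable (noisePath x) :=
  (measurable_noisePosition x).prodMk measurable_noiseRay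

theorem noisePosition_rayVertex (x : ℝ) {ν : Noise} (hν : ∀ i, (ν.2 i).1 (ν.2 i).2 ≠ ⊤) (n : ℕ) :
    noisePosition x ν (rayVertex (noiseRay ν) n) =
      ((x + walk displacement n ν.2 : ℝ) : WithTop ℝ) := by
  induction n with
  | zero => simp [rayVertex, noisePosition]
  | succ n ih =>
    obtain ⟨d, hd⟩ := WithTop.ne_top_iff_exists.1 (hν n)
    have hchild : noiseOffspring ν (rayVertex (noiseRay ν) n) (noiseRay ν n) = (d : WithTop ℝ) := by
      simp only [noiseOffspring, length_rayVertex, if_true, noiseRay, hd]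
    have hstep : displacement (ν.2 n) = d := by rw [displacement, ← hd, WithTop.untopD_coe]
    rw [rayVertex, noisePosition, ih, hchild, walk_succ, hstep, ← WithTop.coe_add, add_assoc]

theorem spinePos_noisePath (x : ℝ) {ν : Noise} (hν : ∀ i, (ν.2 i).1 (ν.2 i).2 ≠ ⊤) (n : ℕ) :
    spinePos n (noisePath x ν) = x + walk displacement n ν.2 := by
  have hpos := noisePosition_rayVertex x hν n
  simp only [spinePos, spine, noisePath, hpos, WithTop.untopD_coe]

variable {Θ : Measure Offspring}

theorem spinalLaw_eq_map (x : ℝ) : spinalLaw Θ x = (noiseLaw Θ).map (noisePath x) := rfl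

theorem ae_noiseLaw_ne_top (hΘ : IsBoundaryCase Θ) :
    ∀ᵐ ν ∂noiseLaw Θ, ∀ i, (ν.2 i).1 (ν.2 i).2 ≠ ⊤ := by
  have := isProbabilityMeasure_spineStep hΘ
  have hsteps : ∀ᵐ ω ∂iidLaw (spineStep Θ), ∀ i, (ω i).1 (ω i).2 ≠ ⊤ := ae_all_iff.2 fun i =>
    (measurePreserving_eval_infinitePi (fun _ : ℕ => spineStep Θ) i).quasiMeasurePreserving.ae
      (ae_spineStep_ne_top hΘ.lintegral_weight_ne_top)
  exact Measure.quasiMeasurePreserving_snd.ae hsteps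

theorem map_spinePos_spinalLaw (hΘ : IsBoundaryCase Θ) (x : ℝ) :
    (spinalLaw Θ x).map (fun ω k => spinePos k ω) =
      (iidLaw (spineStep Θ)).map (fun ω k => x + walk displacement k ω) := by
  have := isProbabilityMeasure_spineStep hΘ
  have := hΘ.prob
  have hpos : Measurable fun (ω : Path) (k : ℕ) => spinePos k ω :=
    measurable_pi_lambda _ measurable_spinePos
  have hwalk : Measurable fun (ω : ℕ → Offspring × ℕ) (k : ℕ) => x + walk displacement k ω :=
    measurable_pi_lambda _ fun k => (measurable_walk measurable_displacement k).const_add x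
  have hsnd : (noiseLaw Θ).map Prod.snd = iidLaw (spineStep Θ) := by
    simp [noiseLaw, Measure.map_snd_prod]
  rw [spinalLaw_eq_map, Measure.map_map hpos (measurable_noisePath x), ← hsnd,
    Measure.map_map hwalk measurable_snd]
  refine Measure.map_congr ?_
  filter_upwards [ae_noiseLaw_ne_top hΘ] with ν hν
  funext k
  exact spinePos_noisePath x hν k

theorem spinalLaw_setOf_spinePos_mem (hΘ : IsBoundaryCase Θ) (x : ℝ) {S : Set (ℕ → ℝ)}
    (hS : MeasurableSet S) :
    spinalLaw Θ x {ω | (fun k => spinePos k ω) ∈ S} =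
      iidLaw (spineStep Θ) {ω | (fun k => x + walk displacement k ω) ∈ S} := by
  have h := DFunLike.congr_fun (map_spinePos_spinalLaw hΘ x) S
  rwa [Measure.map_apply (measurable_pi_lambda _ measurable_spinePos) hS,
    Measure.map_apply (measurable_pi_lambda _ fun k =>
      (measurable_walk measurable_displacement k).const_add x) hS] at h

theorem renewal_eq_descRenewal (hΘ : IsBoundaryCase Θ) :
    renewal Θ = descRenewal (spineStep Θ) displacement := by
  funext x
  refine tsum_congr fun n => ?_
  have hS : MeasurableSet {s : ℕ → ℝ | -x ≤ s n ∧ ∀ k < n, s n < s k} := by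
    simp only [measurableSet_setOfPred]; fun_prop
  have h := spinalLaw_setOf_spinePos_mem hΘ 0 hS
  simp only [zero_add] at h
  exact h

end SpinePosition

section ConditionedWalk

open ProbabilityTheory Preorder

theorem lintegral_trajMeasure_succ {X : ℕ → Type*} [∀ n, MeasurableSpace (X n)] (μ : Measure (X 0))
    [IsProbabilityMeasure μ] (κ : ∀ n, Kernel (∀ i : Finset.Iic n, X i) (X (n + 1)))
    [∀ n, IsMarkovKernel (κ n)] (n : ℕ) {H : (∀ i : Finset.Iic n, X i) → X (n + 1) → ℝ≥0∞}
    (hH : Measurable (Function.uncurry H)) :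
    ∫⁻ ω, H (frestrictLe n ω) (ω (n + 1)) ∂Kernel.trajMeasure μ κ =
      ∫⁻ ω, ∫⁻ e, H (frestrictLe n ω) e ∂κ n (frestrictLe n ω) ∂Kernel.trajMeasure μ κ := by
  have hnext : Measurable fun ω : ∀ n, X n => (frestrictLe (π := X) n ω, ω (n + 1)) := by
    fun_prop
  calc ∫⁻ ω, H (frestrictLe n ω) (ω (n + 1)) ∂Kernel.trajMeasure μ κ
      = ∫⁻ p, H p.1 p.2 ∂((Kernel.trajMeasure μ κ).map (frestrictLe n) ⊗ₘ κ n) := by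
        rw [Kernel.map_frestrictLe_trajMeasure_compProd_eq_map_trajMeasure]
        exact (lintegral_map hH hnext).symm
    _ = ∫⁻ h, ∫⁻ e, H h e ∂κ n h ∂(Kernel.trajMeasure μ κ).map (frestrictLe n) :=
        Measure.lintegral_compProd hH
    _ = _ := lintegral_map hH.lintegral_kernel_prod_right (measurable_frestrictLe n)

variable {E : Type*}

/-- The sequence of terms of the history `h` after its initial one, continued as a constant. It
adapts transition densities, which start from the empty history, to `Kernel.trajMeasure`, which
starts from a given initial term. -/
def historyTail (n : ℕ) (h : Finset.Iic n → E) : ℕ → E :=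
  fun i => h ⟨min (i + 1) n, Finset.mem_Iic.2 (min_le_right _ _)⟩

theorem historyTail_frestrictLe {n : ℕ} (ω : ℕ → E) :
    ∀ i ∈ Set.Iio n, historyTail n (frestrictLe n ω) i = shift 1 ω i := by
  intro i hi
  have hmin : min (i + 1) n = 1 + i := by rw [Set.mem_Iio] at hi; omega
  simp only [historyTail, frestrictLe_apply, hmin, shift]

variable [MeasurableSpace E] {m : Measure E}

theorem measurable_historyTail (n : ℕ) : Measurable (historyTail (E := E) n) := by
  unfold historyTail; fun_prop

/-- A sequence of transition densities with respect to `m`: given `ω 0, …, ω (n - 1)`, the next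
term `ω n` has density `d n ω`. -/
structure IsTransitionDensity (m : Measure E) (d : ℕ → (ℕ → E) → E → ℝ≥0∞) : Prop where
  measurable : ∀ n, Measurable (Function.uncurry (d n))
  dependsOn : ∀ n e, DependsOn (d n · e) (Set.Iio n)
  lintegral_eq_one : ∀ n ω, ∫⁻ e, d n ω e ∂m = 1

/-- The density of the first `n` terms with respect to the i.i.d. law. -/
def prefixDensity (d : ℕ → (ℕ → E) → E → ℝ≥0∞) (n : ℕ) (ω : ℕ → E) : ℝ≥0∞ :=
  ∏ i ∈ Finset.range n, d i ω (ω i)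

/-- The transition kernel from a history to its next term with transition densities `d`. -/
def densityKernel (m : Measure E) [SFinite m] (d : ℕ → (ℕ → E) → E → ℝ≥0∞) (n : ℕ) :
    Kernel (Finset.Iic n → E) E :=
  Kernel.withDensity (Kernel.const _ m) fun h => d n (historyTail n h)

namespace IsTransitionDensity

variable {d : ℕ → (ℕ → E) → E → ℝ≥0∞}

theorem measurable_prefixDensity (hd : IsTransitionDensity m d) (n : ℕ) :
    Measurable (prefixDensity d n) :=
  Finset.measurable_fun_prod _ fun i _ =>
    (hd.measurable i).comp (measurable_id.prodMk (measurable_pi_apply i))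

theorem dependsOn_prefixDensity (hd : IsTransitionDensity m d) (n : ℕ) :
    DependsOn (prefixDensity d n) (Set.Iio n) := by
  refine fun ω ω' hag => Finset.prod_congr rfl fun i hi => ?_
  have hin := Finset.mem_range.1 hi
  rw [hag i hin]
  exact hd.dependsOn i _ fun j hj => hag j (lt_trans hj hin)

theorem measurable_comp_historyTail (hd : IsTransitionDensity m d) (n : ℕ) :
    Measurable (Function.uncurry fun h => d n (historyTail n h)) :=
  (hd.measurable n).comp (((measurable_historyTail n).comp measurable_fst).prodMk measurable_snd)

variable [IsProbabilityMeasure m]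

theorem isMarkovKernel_densityKernel (hd : IsTransitionDensity m d) (n : ℕ) :
    IsMarkovKernel (densityKernel m d n) := by
  refine ⟨fun h => ⟨?_⟩⟩
  rw [densityKernel, Kernel.withDensity_apply' _ (hd.measurable_comp_historyTail n),
    setLIntegral_univ]
  exact hd.lintegral_eq_one n _

theorem exists_lintegral_next (hd : IsTransitionDensity m d) :
    ∃ T : Measure (ℕ → E), IsProbabilityMeasure T ∧
      ∀ (n : ℕ) {G : (ℕ → E) → E → ℝ≥0∞}, Measurable (Function.uncurry G) →
        (∀ e, DependsOn (G · e) (Set.Iio n)) →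
        ∫⁻ ω, G ω (ω n) ∂T = ∫⁻ ω, ∫⁻ e, d n ω e * G ω e ∂m ∂T := by
  have := hd.isMarkovKernel_densityKernel
  have hshift : Measurable (shift (E := E) 1) := measurable_shift 1
  let T₀ : Measure (ℕ → E) := Kernel.trajMeasure (X := fun _ => E) m (densityKernel m d)
  refine ⟨T₀.map (shift 1), Measure.isProbabilityMeasure_map hshift.aemeasurable,
    fun n G hG hGdep => ?_⟩
  have hGnext : Measurable fun ω : ℕ → E => G ω (ω n) :=
    hG.comp (measurable_id.prodMk (measurable_pi_apply n))
  have hGint : Measurable fun ω : ℕ → E => ∫⁻ e, d n ω e * G ω e ∂m :=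
    ((hd.measurable n).mul hG).lintegral_prod_right'
  have hGtail : Measurable (Function.uncurry fun h => G (historyTail n h)) :=
    hG.comp (((measurable_historyTail n).comp measurable_fst).prodMk measurable_snd)
  rw [lintegral_map hGnext hshift, lintegral_map hGint hshift]
  calc ∫⁻ ω, G (shift 1 ω) (shift 1 ω n) ∂T₀
      = ∫⁻ ω, G (historyTail n (frestrictLe n ω)) (ω (n + 1)) ∂T₀ :=
        lintegral_congr fun ω => by
          simpa only [shift, add_comm 1] using (hGdep (ω (n + 1)) (historyTail_frestrictLe ω)).symm
    _ = ∫⁻ ω, ∫⁻ e, G (historyTail n (frestrictLe n ω)) e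
          ∂densityKernel m d n (frestrictLe n ω) ∂T₀ :=
        lintegral_trajMeasure_succ (X := fun _ => E) m (densityKernel m d) n hGtail
    _ = ∫⁻ ω, ∫⁻ e, d n (historyTail n (frestrictLe n ω)) e *
          G (historyTail n (frestrictLe n ω)) e ∂m ∂T₀ := lintegral_congr fun ω =>
        Kernel.lintegral_withDensity _ (hd.measurable_comp_historyTail n) _ hGtail.of_uncurry_left
    _ = ∫⁻ ω, ∫⁻ e, d n (shift 1 ω) e * G (shift 1 ω) e ∂m ∂T₀ := by
        refine lintegral_congr fun ω => lintegral_congr fun e => ?_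
        exact congrArg₂ (· * ·) (hd.dependsOn n e (historyTail_frestrictLe ω))
          (hGdep e (historyTail_frestrictLe ω))

theorem lintegral_mul_prefixDensity_succ (hd : IsTransitionDensity m d) (n : ℕ)
    {G : (ℕ → E) → E → ℝ≥0∞} (hG : Measurable (Function.uncurry G))
    (hGdep : ∀ e, DependsOn (G · e) (Set.Iio n)) :
    ∫⁻ ω, G ω (ω n) * prefixDensity d (n + 1) ω ∂iidLaw m =
      ∫⁻ ω, (∫⁻ e, d n ω e * G ω e ∂m) * prefixDensity d n ω ∂iidLaw m := by
  have hdG : Measurable (Function.uncurry fun ω e => d n ω e * G ω e) := (hd.measurable n).mul hG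
  let F (ω : ℕ → E) (e : E) : ℝ≥0∞ := d n ω e * G ω e * prefixDensity d n ω
  have hF : Measurable (Function.uncurry F) :=
    hdG.mul ((hd.measurable_prefixDensity n).comp measurable_fst)
  have hFdep (e : E) : DependsOn (F · e) (Set.Iio n) := fun ω ω' hag =>
    congrArg₂ (· * ·) (congrArg₂ (· * ·) (hd.dependsOn n e hag) (hGdep e hag))
      (hd.dependsOn_prefixDensity n hag)
  calc ∫⁻ ω, G ω (ω n) * prefixDensity d (n + 1) ω ∂iidLaw m = ∫⁻ ω, F ω (ω n) ∂iidLaw m := by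
        refine lintegral_congr fun ω => ?_
        simp only [F, prefixDensity, Finset.prod_range_succ]
        ring
    _ = ∫⁻ ω, ∫⁻ e, F ω e ∂m ∂iidLaw m := lintegral_next m n hF hFdep
    _ = ∫⁻ ω, (∫⁻ e, d n ω e * G ω e ∂m) * prefixDensity d n ω ∂iidLaw m :=
        lintegral_congr fun ω => lintegral_mul_const _ hdG.of_uncurry_left

theorem exists_lintegral_eq (hd : IsTransitionDensity m d) :
    ∃ T : Measure (ℕ → E), IsProbabilityMeasure T ∧
      ∀ (n : ℕ) {F : (ℕ → E) → ℝ≥0∞}, Measurable F → DependsOn F (Set.Iio n) →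
        ∫⁻ ω, F ω ∂T = ∫⁻ ω, F ω * prefixDensity d n ω ∂iidLaw m := by
  obtain ⟨T, hT, hnext⟩ := hd.exists_lintegral_next
  refine ⟨T, hT, fun n => ?_⟩
  induction n with
  | zero =>
    intro F _ hFdep
    have hconst : ∀ ω ω', F ω = F ω' := fun ω ω' => hFdep fun i hi => absurd hi (by simp)
    obtain ⟨ω₀⟩ : Nonempty (ℕ → E) := nonempty_of_isProbabilityMeasure T
    simp [hconst _ ω₀, prefixDensity]
  | succ n ih =>
    intro F hF hFdep
    let G (ω : ℕ → E) (e : E) : ℝ≥0∞ := F (Function.update ω n e)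
    have hG : Measurable (Function.uncurry G) := hF.comp measurable_update'
    have hGdep (e : E) : DependsOn (G · e) (Set.Iio n) := fun ω ω' hag => hFdep fun i hi => by
      rcases (Nat.lt_succ_iff.1 hi).lt_or_eq with hin | rfl
      · simp [hin.ne, hag i hin]
      · simp
    have hdG : Measurable (Function.uncurry fun ω e => d n ω e * G ω e) := (hd.measurable n).mul hG
    calc ∫⁻ ω, F ω ∂T = ∫⁻ ω, G ω (ω n) ∂T := by simp only [G, Function.update_eq_self]
      _ = ∫⁻ ω, ∫⁻ e, d n ω e * G ω e ∂m ∂T := hnext n hG hGdep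
      _ = ∫⁻ ω, (∫⁻ e, d n ω e * G ω e ∂m) * prefixDensity d n ω ∂iidLaw m :=
          ih hdG.lintegral_prod_right' fun ω ω' hag => lintegral_congr fun e =>
            congrArg₂ (· * ·) (hd.dependsOn n e hag) (hGdep e hag)
      _ = ∫⁻ ω, G ω (ω n) * prefixDensity d (n + 1) ω ∂iidLaw m :=
          (hd.lintegral_mul_prefixDensity_succ n hG hGdep).symm
      _ = ∫⁻ ω, F ω * prefixDensity d (n + 1) ω ∂iidLaw m := by
          simp only [G, Function.update_eq_self]

end IsTransitionDensity

variable {g : E → ℝ}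

/-- The density on the first `n` steps of the walk started at `x` and conditioned to stay
nonnegative, i.e. of the Doob transform by `descRenewal` of the walk killed below `0`. -/
def walkDensity (m : Measure E) (g : E → ℝ) (x : ℝ) (n : ℕ) : (ℕ → E) → ℝ≥0∞ :=
  (survival g x n).indicator fun ω => descRenewal m g (x + walk g n ω) / descRenewal m g x

open Classical in
/-- The density of the step from `y` of the walk conditioned to stay nonnegative. The value at
`y < 0`, which that walk does not reach, makes it a probability density there too. -/
def stepDensity (m : Measure E) (g : E → ℝ) (y : ℝ) (e : E) : ℝ≥0∞ :=
  if 0 ≤ y then descRenewal m g (y + g e) / descRenewal m g y else 1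

theorem measurable_walkDensity (hg : Measurable g) (x : ℝ) (n : ℕ) :
    Measurable (walkDensity m g x n) :=
  ((measurable_descRenewal.comp ((measurable_walk hg n).const_add x)).div_const _).indicator
    (measurableSet_survival hg x n)

theorem measurable_stepDensity (hg : Measurable g) :
    Measurable (Function.uncurry (stepDensity m g)) :=
  Measurable.ite (measurableSet_le measurable_const measurable_fst)
    ((measurable_descRenewal.comp (measurable_fst.add (hg.comp measurable_snd))).div
      (measurable_descRenewal.comp measurable_fst)) measurable_const

namespace IsCenteredStep

variable [IsProbabilityMeasure m]

theorem descRenewal_div_self (h : IsCenteredStep m g) {x : ℝ} (hx : 0 ≤ x) :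
    descRenewal m g x / descRenewal m g x = 1 :=
  ENNReal.div_self (zero_lt_one.trans_le (one_le_descRenewal m hx)).ne'
    (descRenewal_ne_top m h.measurable h.neg x)

theorem isTransitionDensity_stepDensity (h : IsCenteredStep m g) (x : ℝ) :
    IsTransitionDensity m fun n ω => stepDensity m g (x + walk g n ω) where
  measurable n := (measurable_stepDensity h.measurable).comp
    ((((measurable_walk h.measurable n).const_add x).comp measurable_fst).prodMk measurable_snd)
  dependsOn n e ω ω' hag := by simp only [dependsOn_walk g n hag]
  lintegral_eq_one n ω := by
    by_cases h0 : 0 ≤ x + walk g n ω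
    · have hR : Measurable fun e => descRenewal m g (x + walk g n ω + g e) :=
        measurable_descRenewal.comp (h.measurable.const_add _)
      simp only [stepDensity, h0, if_true, div_eq_mul_inv]
      rw [lintegral_mul_const _ hR, lintegral_descRenewal h h0, ← div_eq_mul_inv,
        h.descRenewal_div_self h0]
    · simp [stepDensity, h0]

theorem walkDensity_succ (h : IsCenteredStep m g) (x : ℝ) (n : ℕ) (ω : ℕ → E) :
    walkDensity m g x (n + 1) ω =
      walkDensity m g x n ω * stepDensity m g (x + walk g n ω) (ω n) := by
  have hsucc : ω ∈ survival g x (n + 1) ↔ ω ∈ survival g x n ∧ 0 ≤ x + walk g (n + 1) ω :=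
    by simp only [survival, Set.mem_ofPred_eq, Nat.le_succ_iff, or_imp, forall_and, forall_eq]
  by_cases hn : ω ∈ survival g x n
  · have hpos : 0 ≤ x + walk g n ω := hn n le_rfl
    have hdensity : walkDensity m g x (n + 1) ω =
        descRenewal m g (x + walk g (n + 1) ω) / descRenewal m g x := by
      by_cases hnext : 0 ≤ x + walk g (n + 1) ω
      · exact Set.indicator_of_mem (hsucc.2 ⟨hn, hnext⟩) _
      · rw [descRenewal_of_neg m (not_le.1 hnext), ENNReal.zero_div]
        exact Set.indicator_of_notMem (fun hmem => hnext (hsucc.1 hmem).2) _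
    rw [hdensity, walkDensity, Set.indicator_of_mem hn, stepDensity, if_pos hpos, walk_succ,
      ← add_assoc, ← mul_div_assoc, ENNReal.mul_comm_div, ENNReal.mul_div_right_comm,
      h.descRenewal_div_self hpos, one_mul]
  · rw [walkDensity, walkDensity, Set.indicator_of_notMem hn,
      Set.indicator_of_notMem fun hmem => hn (hsucc.1 hmem).1, zero_mul]

theorem walkDensity_eq_prefixDensity (h : IsCenteredStep m g) {x : ℝ} (hx : 0 ≤ x) (n : ℕ)
    (ω : ℕ → E) :
    walkDensity m g x n ω =
      prefixDensity (fun n ω => stepDensity m g (x + walk g n ω)) n ω := by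
  induction n with
  | zero => simp [walkDensity, prefixDensity, survival, hx, h.descRenewal_div_self hx]
  | succ n ih => rw [h.walkDensity_succ, ih, prefixDensity, prefixDensity, Finset.prod_range_succ]

theorem exists_lintegral_eq_walkDensity (h : IsCenteredStep m g) {x : ℝ} (hx : 0 ≤ x) :
    ∃ T : Measure (ℕ → E), IsProbabilityMeasure T ∧
      ∀ (n : ℕ) {F : (ℕ → E) → ℝ≥0∞}, Measurable F → DependsOn F (Set.Iio n) →
        ∫⁻ ω, F ω ∂T = ∫⁻ ω, F ω * walkDensity m g x n ω ∂iidLaw m := by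
  simp only [h.walkDensity_eq_prefixDensity hx]
  exact (h.isTransitionDensity_stepDensity x).exists_lintegral_eq

end IsCenteredStep

end ConditionedWalk

section PositiveLaw

/-- The positions of the particles of generation at most `n`, and the first `n + 1` vertices of the
spine. -/
def pathUpTo (n : ℕ) (ω : Path) :
    ({u : Vertex // u.length ≤ n} → WithTop ℝ) × ({k : ℕ // k ≤ n} → Vertex) :=
  (fun u => ω.1 u, fun k => spine k ω)

theorem sigmaUpTo_le_comap_pathUpTo (n : ℕ) :
    sigmaUpTo n ≤ MeasurableSpace.comap (pathUpTo n) ⊤ := by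
  refine sup_le (iSup₂_le fun u hu => ?_) (iSup₂_le fun k hk => ?_)
  · rintro _ ⟨B, -, rfl⟩
    exact ⟨{p | p.1 ⟨u, hu⟩ ∈ B}, trivial, rfl⟩
  · rintro _ ⟨B, -, rfl⟩
    exact ⟨{p | p.2 ⟨k, hk⟩ ∈ B}, trivial, rfl⟩

theorem dependsOn_rayVertex (n : ℕ) : DependsOn (rayVertex · n) (Set.Iio n) := by
  induction n with
  | zero => exact fun _ _ _ => rfl
  | succ n ih =>
    exact fun r r' hag => congrArg₂ List.cons (hag n (Nat.lt_succ_self n))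
      (ih fun i hi => hag i (Nat.lt_succ_of_lt hi))

theorem dependsOn_rayVertex_noiseRay (ν₁ : Vertex → Offspring) {k n : ℕ} (hk : k ≤ n) :
    DependsOn (fun ω => rayVertex (noiseRay (ν₁, ω)) k) (Set.Iio n) := fun _ _ hag =>
  dependsOn_rayVertex k fun i hi => congrArg Prod.snd (hag i (lt_of_lt_of_le hi hk))

theorem dependsOn_noisePosition (x : ℝ) (ν₁ : Vertex → Offspring) {n : ℕ} {u : Vertex}
    (hu : u.length ≤ n) : DependsOn (fun ω => noisePosition x (ν₁, ω) u) (Set.Iio n) := by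
  intro ω ω' hag
  induction u with
  | nil => rfl
  | cons i u ih =>
    have hlt : u.length < n := Nat.lt_of_succ_le hu
    have hray := dependsOn_rayVertex_noiseRay ν₁ hlt.le hag
    dsimp only at hray ⊢
    rw [noisePosition, noisePosition]
    exact congrArg₂ (· + ·) (ih hlt.le) (by simp only [noiseOffspring, hray, hag _ hlt])

theorem dependsOn_noisePath_mem (x : ℝ) (ν₁ : Vertex → Offspring) {n : ℕ} {A : Set Path}
    (hA : MeasurableSet[sigmaUpTo n] A) :
    DependsOn (fun ω => noisePath x (ν₁, ω) ∈ A) (Set.Iio n) := by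
  intro ω ω' hag
  obtain ⟨B, -, rfl⟩ := sigmaUpTo_le_comap_pathUpTo n A hA
  exact congrArg (· ∈ B) (Prod.ext
    (funext fun u => dependsOn_noisePosition x ν₁ u.2 hag)
    (funext fun k => dependsOn_rayVertex_noiseRay ν₁ k.2 hag))

variable {Θ : Measure Offspring}

theorem measurable_positiveDensity (hΘ : IsBoundaryCase Θ) (x : ℝ) (n : ℕ) :
    Measurable (positiveDensity Θ x n) := by
  unfold positiveDensity
  rw [renewal_eq_descRenewal hΘ]
  refine Measurable.ite ?_
    ((measurable_descRenewal.comp (measurable_spinePos n)).div_const _) measurable_const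
  have := measurable_spinePos
  simp only [measurableSet_setOfPred]
  fun_prop

theorem positiveDensity_noisePath (hΘ : IsBoundaryCase Θ) (x : ℝ) (n : ℕ) {ν : Noise}
    (hν : ∀ i, (ν.2 i).1 (ν.2 i).2 ≠ ⊤) :
    positiveDensity Θ x n (noisePath x ν) = walkDensity (spineStep Θ) displacement x n ν.2 := by
  classical
  simp only [positiveDensity, walkDensity, Set.indicator_apply, survival, Set.mem_ofPred_eq,
    spinePos_noisePath x hν, renewal_eq_descRenewal hΘ]

theorem setLIntegral_positiveDensity (hΘ : IsBoundaryCase Θ) (x : ℝ) (n : ℕ) {A : Set Path}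
    (hA : MeasurableSet A) :
    ∫⁻ ω in A, positiveDensity Θ x n ω ∂spinalLaw Θ x =
      ∫⁻ ν₁, ∫⁻ ω, (noisePath x ⁻¹' A).indicator 1 (ν₁, ω) *
        walkDensity (spineStep Θ) displacement x n ω ∂iidLaw (spineStep Θ)
        ∂Measure.infinitePi fun _ : Vertex => Θ := by
  have := isProbabilityMeasure_spineStep hΘ
  have hpreA : MeasurableSet (noisePath x ⁻¹' A) := measurable_noisePath x hA
  have hprod : Measurable fun ν : Noise => (noisePath x ⁻¹' A).indicator (1 : Noise → ℝ≥0∞) ν *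
      walkDensity (spineStep Θ) displacement x n ν.2 :=
    (measurable_one.indicator hpreA).mul
      ((measurable_walkDensity measurable_displacement x n).comp measurable_snd)
  rw [spinalLaw_eq_map, setLIntegral_map hA (measurable_positiveDensity hΘ x n)
    (measurable_noisePath x), ← lintegral_indicator hpreA]
  refine (lintegral_congr_ae ?_).trans (lintegral_prod _ hprod.aemeasurable)
  filter_upwards [ae_noiseLaw_ne_top hΘ] with ν hν
  by_cases hmem : ν ∈ noisePath x ⁻¹' A
  · rw [Set.indicator_of_mem hmem, Set.indicator_of_mem hmem, Pi.one_apply, one_mul,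
      positiveDensity_noisePath hΘ x n hν]
  · rw [Set.indicator_of_notMem hmem, Set.indicator_of_notMem hmem, zero_mul]

theorem exists_isPositiveSpineLaw (hΘ : IsBoundaryCase Θ) {x : ℝ} (hx : 0 ≤ x) :
    ∃ Q : Measure Path, IsPositiveSpineLaw Θ x Q := by
  have := isProbabilityMeasure_spineStep hΘ
  have := hΘ.prob
  obtain ⟨T, hT, hdensity⟩ := hΘ.isCenteredStep_displacement.exists_lintegral_eq_walkDensity hx
  refine ⟨((Measure.infinitePi fun _ : Vertex => Θ).prod T).map (noisePath x),
    Measure.isProbabilityMeasure_map (measurable_noisePath x).aemeasurable, fun n A hA => ?_⟩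
  have hA' : MeasurableSet A := sigmaUpTo_le n A hA
  have hind : Measurable ((noisePath x ⁻¹' A).indicator (1 : Noise → ℝ≥0∞)) :=
    measurable_one.indicator (measurable_noisePath x hA')
  rw [Measure.map_apply (measurable_noisePath x) hA', setLIntegral_positiveDensity hΘ x n hA',
    ← lintegral_indicator_one (measurable_noisePath x hA'), lintegral_prod _ hind.aemeasurable]
  refine lintegral_congr fun ν₁ => hdensity n (hind.comp measurable_prodMk_left) ?_
  exact fun ω ω' hag => Set.indicator_const_eq_indicator_const
    (iff_of_eq (dependsOn_noisePath_mem x ν₁ hA hag))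

end PositiveLaw

section Potential

theorem exists_strictDescent_Icc_bound {E : Type*} [MeasurableSpace E] (m : Measure E)
    [IsProbabilityMeasure m] {g : E → ℝ} (hg : Measurable g) (hneg : 0 < m {e | g e < 0}) :
    ∃ K : ℝ≥0∞, K ≠ ∞ ∧ ∀ (x : ℝ) (a : ℕ),
      ∑' n : ℕ, iidLaw m (walk g n ⁻¹' Set.Icc (-x) (a + 1 - x) ∩ strictDescent g n) ≤
        min (descRenewal m g x) (K * (a + 2)) := by
  obtain ⟨K, hK, hwindow⟩ := exists_strictDescent_bound m hg hneg
  refine ⟨K, hK, fun x a => le_min ?_ ?_⟩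
  · exact ENNReal.tsum_le_tsum fun n => measure_mono
      (Set.inter_subset_inter_left _ (Set.preimage_mono Set.Icc_subset_Ici_self))
  · have h := hwindow (-x) (a + 1)
    push_cast at h
    rwa [neg_add_eq_sub, add_assoc (a : ℝ≥0∞), one_add_one_eq_two] at h

variable {Θ : Measure Offspring}

namespace IsPositiveSpineLaw

variable {x : ℝ} {Q : Measure Path}

theorem ae_nonneg (hQ : IsPositiveSpineLaw Θ x Q) (k : ℕ) : ∀ᵐ ω ∂Q, 0 ≤ spinePos k ω := by
  have hs : MeasurableSet[sigmaUpTo k] (spinePos k ⁻¹' Set.Iio 0) :=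
    measurable_sigmaUpTo_spinePos le_rfl measurableSet_Iio
  have hzero : Q (spinePos k ⁻¹' Set.Iio 0) = 0 := by
    rw [hQ.density k _ hs]
    refine setLIntegral_eq_zero (sigmaUpTo_le k _ hs) fun ω hω => ?_
    exact if_neg fun hnonneg => (hnonneg k le_rfl).not_gt hω
  simp only [ae_iff, not_le]
  exact hzero

theorem measure_preimage_Ico_le (hΘ : IsBoundaryCase Θ) (hQ : IsPositiveSpineLaw Θ x Q) (k : ℕ)
    (a : ℝ) :
    Q (spinePos k ⁻¹' Set.Ico a (a + 1)) ≤ renewal Θ (a + 1) / renewal Θ x *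
      iidLaw (spineStep Θ) ((fun ω => x + walk displacement k ω) ⁻¹' Set.Icc a (a + 1) ∩
        survival displacement x k) := by
  have hs : MeasurableSet[sigmaUpTo k] (spinePos k ⁻¹' Set.Ico a (a + 1)) :=
    measurable_sigmaUpTo_spinePos le_rfl measurableSet_Ico
  let S : Set (ℕ → ℝ) := {s | s k ∈ Set.Icc a (a + 1) ∧ ∀ j ≤ k, 0 ≤ s j}
  have hS : MeasurableSet S := by
    simp only [S, Set.mem_Icc, measurableSet_setOfPred]; fun_prop
  have hS' : MeasurableSet {ω | (fun k => spinePos k ω) ∈ S} :=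
    measurable_pi_lambda (fun ω k => spinePos k ω) measurable_spinePos hS
  calc Q (spinePos k ⁻¹' Set.Ico a (a + 1))
      = ∫⁻ ω in spinePos k ⁻¹' Set.Ico a (a + 1), positiveDensity Θ x k ω ∂spinalLaw Θ x :=
        hQ.density k _ hs
    _ ≤ ∫⁻ ω, renewal Θ (a + 1) / renewal Θ x *
          {ω | (fun k => spinePos k ω) ∈ S}.indicator 1 ω ∂spinalLaw Θ x := by
        rw [← lintegral_indicator (sigmaUpTo_le k _ hs)]
        refine lintegral_mono fun ω => Set.indicator_apply_le' (fun hω => ?_) fun _ => bot_le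
        rw [positiveDensity]
        split_ifs with hnonneg
        · have hmem : ω ∈ {ω | (fun k => spinePos k ω) ∈ S} :=
            ⟨Set.Ico_subset_Icc_self hω, hnonneg⟩
          rw [Set.indicator_of_mem hmem, Pi.one_apply, mul_one, renewal_eq_descRenewal hΘ]
          exact ENNReal.div_le_div_right (descRenewal_mono _ hω.2.le) _
        · exact bot_le
    _ = _ := by
        rw [lintegral_const_mul _ (measurable_one.indicator hS'), lintegral_indicator_one hS',
          spinalLaw_setOf_spinePos_mem hΘ x hS]
        rfl

end IsPositiveSpineLaw

theorem exists_tsum_measure_preimage_Ico_bound (hΘ : IsBoundaryCase Θ) :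
    ∃ C K : ℝ≥0∞, C ≠ ∞ ∧ K ≠ ∞ ∧ ∀ {x : ℝ} {Q : Measure Path}, 0 ≤ x →
      IsPositiveSpineLaw Θ x Q → ∀ a : ℕ,
      ∑' k : ℕ, Q (spinePos k ⁻¹' Set.Ico (a : ℝ) (a + 1)) ≤
        C * renewal Θ (a + 1) * min 1 (K * (a + 2) / renewal Θ x) := by
  have := isProbabilityMeasure_spineStep hΘ
  have hstep := hΘ.isCenteredStep_displacement
  obtain ⟨C, hC, hgreen⟩ := exists_green_bound (spineStep Θ) hstep.measurable hstep.pos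
  obtain ⟨K, hK, hladder⟩ :=
    exists_strictDescent_Icc_bound (spineStep Θ) hstep.measurable hstep.neg
  refine ⟨C, K, hC, hK, fun {x Q} hx hQ a => ?_⟩
  have hdiv : renewal Θ x / renewal Θ x = 1 := by
    rw [renewal_eq_descRenewal hΘ]
    exact hstep.descRenewal_div_self hx
  calc ∑' k : ℕ, Q (spinePos k ⁻¹' Set.Ico (a : ℝ) (a + 1))
      ≤ ∑' k : ℕ, renewal Θ (a + 1) / renewal Θ x *
          iidLaw (spineStep Θ) ((fun ω => x + walk displacement k ω) ⁻¹' Set.Icc (a : ℝ) (a + 1) ∩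
            survival displacement x k) :=
        ENNReal.tsum_le_tsum fun k => hQ.measure_preimage_Ico_le hΘ k a
    _ ≤ renewal Θ (a + 1) / renewal Θ x * (C * min (renewal Θ x) (K * (a + 2))) := by
        rw [ENNReal.tsum_mul_left, renewal_eq_descRenewal hΘ]
        gcongr
        exact (hgreen x a).trans (mul_right_mono (hladder x a))
    _ = C * renewal Θ (a + 1) * (min (renewal Θ x) (K * (a + 2)) / renewal Θ x) := by
        simp only [div_eq_mul_inv]; ring
    _ ≤ C * renewal Θ (a + 1) * min 1 (K * (a + 2) / renewal Θ x) := by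
        refine mul_right_mono (le_min ?_ (ENNReal.div_le_div_right (min_le_right _ _) _))
        exact (ENNReal.div_le_div_right (min_le_left _ _) _).trans hdiv.le

variable {f : ℝ → ℝ}

theorem lintegral_ofReal_comp_le_tsum {Ω : Type*} [MeasurableSpace Ω] {μ : Measure Ω} {Y : Ω → ℝ}
    (hf_anti : AntitoneOn f (Set.Ici 0)) (hY : Measurable Y) (hY_nonneg : ∀ᵐ ω ∂μ, 0 ≤ Y ω) :
    ∫⁻ ω, ENNReal.ofReal (f (Y ω)) ∂μ ≤
      ∑' a : ℕ, ENNReal.ofReal (f a) * μ (Y ⁻¹' Set.Ico (a : ℝ) (a + 1)) := by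
  have hcover : ∀ᵐ ω ∂μ, ω ∈ ⋃ a : ℕ, Y ⁻¹' Set.Ico (a : ℝ) (a + 1) := by
    filter_upwards [hY_nonneg] with ω hω
    exact Set.mem_iUnion.2 ⟨⌊Y ω⌋₊, Nat.floor_le hω, Nat.lt_floor_add_one _⟩
  calc ∫⁻ ω, ENNReal.ofReal (f (Y ω)) ∂μ
      = ∫⁻ ω in ⋃ a : ℕ, Y ⁻¹' Set.Ico (a : ℝ) (a + 1), ENNReal.ofReal (f (Y ω)) ∂μ := by
        rw [Measure.restrict_eq_self_of_ae_mem hcover]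
    _ ≤ ∑' a : ℕ, ∫⁻ ω in Y ⁻¹' Set.Ico (a : ℝ) (a + 1), ENNReal.ofReal (f (Y ω)) ∂μ :=
        lintegral_iUnion_le _ _
    _ ≤ ∑' a : ℕ, ENNReal.ofReal (f a) * μ (Y ⁻¹' Set.Ico (a : ℝ) (a + 1)) := by
        refine ENNReal.tsum_le_tsum fun a => ?_
        rw [← setLIntegral_const]
        refine setLIntegral_mono' (hY measurableSet_Ico) fun ω hω => ENNReal.ofReal_le_ofReal ?_
        have ha : (0 : ℝ) ≤ a := a.cast_nonneg
        exact hf_anti ha (ha.trans hω.1) hω.1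

theorem IsPositiveSpineLaw.lintegral_tsum_ofReal_le (hf_anti : AntitoneOn f (Set.Ici 0)) {x : ℝ}
    {Q : Measure Path} (hQ : IsPositiveSpineLaw Θ x Q) :
    ∫⁻ ω, ∑' k : ℕ, ENNReal.ofReal (f (spinePos k ω)) ∂Q ≤
      ∑' a : ℕ, ENNReal.ofReal (f a) * ∑' k : ℕ, Q (spinePos k ⁻¹' Set.Ico (a : ℝ) (a + 1)) := by
  have hmeas (k : ℕ) : AEMeasurable (fun ω => ENNReal.ofReal (f (spinePos k ω))) Q := by
    have hsupp : ∀ᵐ y ∂Q.map (spinePos k), y ∈ Set.Ici 0 :=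
      (ae_map_iff (measurable_spinePos k).aemeasurable measurableSet_Ici).2 (hQ.ae_nonneg k)
    have hf : AEMeasurable f (Q.map (spinePos k)) := by
      rw [← Measure.restrict_eq_self_of_ae_mem hsupp]
      exact aemeasurable_restrict_of_antitoneOn measurableSet_Ici hf_anti
    exact (hf.comp_measurable (measurable_spinePos k)).ennreal_ofReal
  simp only [← ENNReal.tsum_mul_left]
  rw [lintegral_tsum hmeas, ENNReal.tsum_comm]
  exact ENNReal.tsum_le_tsum fun k =>
    lintegral_ofReal_comp_le_tsum hf_anti (measurable_spinePos k) (hQ.ae_nonneg k)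

theorem ofReal_mul_le_setLIntegral_Ioc (hf_nonneg : ∀ y, 0 ≤ y → 0 ≤ f y)
    (hf_anti : AntitoneOn f (Set.Ici 0)) (c : ℕ) :
    ENNReal.ofReal (f (c + 2 : ℕ)) * ((c + 2 : ℕ) + 2) ≤
      ∫⁻ y in Set.Ioc ((c + 1 : ℕ) : ℝ) (c + 1 + 1 : ℕ), ENNReal.ofReal (4 * (y * f y)) := by
  have hcast : ((c + 2 : ℕ) + 2 : ℝ≥0∞) = ENNReal.ofReal ((c + 2 : ℕ) + 2) := by
    rw [ENNReal.ofReal_add (Nat.cast_nonneg _) zero_le_two, ENNReal.ofReal_natCast,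
      ENNReal.ofReal_ofNat]
  calc ENNReal.ofReal (f (c + 2 : ℕ)) * ((c + 2 : ℕ) + 2)
      = ∫⁻ _ in Set.Ioc ((c + 1 : ℕ) : ℝ) (c + 1 + 1 : ℕ),
          ENNReal.ofReal (f (c + 2 : ℕ) * ((c + 2 : ℕ) + 2)) := by
        rw [hcast, ← ENNReal.ofReal_mul (hf_nonneg _ (Nat.cast_nonneg _))]
        simp
    _ ≤ _ := by
        refine setLIntegral_mono' measurableSet_Ioc fun y hy => ENNReal.ofReal_le_ofReal ?_
        obtain ⟨hlow, hupp⟩ := hy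
        have hy0 : 0 ≤ y := (Nat.cast_nonneg _).trans hlow.le
        have hfy : f (c + 2 : ℕ) ≤ f y := hf_anti hy0 (Set.mem_Ici.2 (Nat.cast_nonneg _)) hupp
        push_cast at hlow hfy ⊢
        nlinarith [hf_nonneg y hy0]

theorem tsum_ofReal_mul_ne_top (hf_nonneg : ∀ y, 0 ≤ y → 0 ≤ f y)
    (hf_anti : AntitoneOn f (Set.Ici 0)) (hf_int : IntegrableOn (fun y => y * f y) (Set.Ioi 0)) :
    ∑' a : ℕ, ENNReal.ofReal (f a) * (a + 2) ≠ ∞ := by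
  have htail : ∑' c : ℕ, ENNReal.ofReal (f (c + 2 : ℕ)) * ((c + 2 : ℕ) + 2) ≠ ∞ := by
    refine ne_top_of_le_ne_top (Integrable.lintegral_lt_top (hf_int.const_mul 4)).ne ?_
    calc _ ≤ ∑' c : ℕ, ∫⁻ y in Set.Ioc ((c + 1 : ℕ) : ℝ) (c + 1 + 1 : ℕ),
              ENNReal.ofReal (4 * (y * f y)) :=
          ENNReal.tsum_le_tsum (ofReal_mul_le_setLIntegral_Ioc hf_nonneg hf_anti)
      _ = ∫⁻ y in ⋃ c : ℕ, Set.Ioc ((c + 1 : ℕ) : ℝ) (c + 1 + 1 : ℕ),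
            ENNReal.ofReal (4 * (y * f y)) := by
          refine (lintegral_iUnion (fun c => measurableSet_Ioc) ?_ _).symm
          exact Monotone.pairwise_disjoint_on_Ioc_succ (f := fun c : ℕ => ((c + 1 : ℕ) : ℝ))
            fun b c hbc => Nat.cast_le.2 (Nat.succ_le_succ hbc)
      _ ≤ ∫⁻ y in Set.Ioi 0, ENNReal.ofReal (4 * (y * f y)) :=
          lintegral_mono_set (Set.iUnion_subset fun c y hy => (Nat.cast_nonneg _).trans_lt hy.1)
  rw [← ENNReal.summable.sum_add_tsum_nat_add' (k := 2)]
  refine ENNReal.add_ne_top.2 ⟨ENNReal.sum_ne_top.2 fun a _ => ?_, htail⟩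
  exact ENNReal.mul_ne_top ENNReal.ofReal_ne_top (by simp)

theorem tsum_ofReal_mul_renewal_ne_top (hΘ : IsBoundaryCase Θ)
    (hf_nonneg : ∀ y, 0 ≤ y → 0 ≤ f y) (hf_anti : AntitoneOn f (Set.Ici 0))
    (hf_int : IntegrableOn (fun y => y * f y) (Set.Ioi 0)) :
    ∑' a : ℕ, ENNReal.ofReal (f a) * renewal Θ (a + 1) ≠ ∞ := by
  have := isProbabilityMeasure_spineStep hΘ
  have hstep := hΘ.isCenteredStep_displacement
  obtain ⟨C, hC, hlinear⟩ := exists_descRenewal_bound (spineStep Θ) hstep.measurable hstep.neg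
  refine ne_top_of_le_ne_top
    (ENNReal.mul_ne_top hC (tsum_ofReal_mul_ne_top hf_nonneg hf_anti hf_int)) ?_
  rw [← ENNReal.tsum_mul_left, renewal_eq_descRenewal hΘ]
  refine ENNReal.tsum_le_tsum fun a => ?_
  have hbound := hlinear (a + 1)
  push_cast at hbound
  rw [add_assoc (a : ℝ≥0∞), one_add_one_eq_two] at hbound
  rw [mul_left_comm]
  gcongr

theorem exists_lintegral_tsum_bound (hΘ : IsBoundaryCase Θ) (hf_nonneg : ∀ y, 0 ≤ y → 0 ≤ f y)
    (hf_anti : AntitoneOn f (Set.Ici 0)) (hf_int : IntegrableOn (fun y => y * f y) (Set.Ioi 0)) :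
    ∃ u v : ℕ → ℝ≥0∞, ∑' a, u a ≠ ∞ ∧ (∀ a, v a ≠ ∞) ∧ ∀ {x : ℝ} {Q : Measure Path}, 0 ≤ x →
      IsPositiveSpineLaw Θ x Q → ∫⁻ ω, ∑' k : ℕ, ENNReal.ofReal (f (spinePos k ω)) ∂Q ≤
        ∑' a, u a * min 1 (v a / renewal Θ x) := by
  obtain ⟨C, K, hC, hK, hwindow⟩ := exists_tsum_measure_preimage_Ico_bound hΘ
  refine ⟨fun a => C * (ENNReal.ofReal (f a) * renewal Θ (a + 1)), fun a => K * (a + 2), ?_,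
    fun a => ENNReal.mul_ne_top hK (by simp), fun {x Q} hx hQ => ?_⟩
  · rw [ENNReal.tsum_mul_left]
    exact ENNReal.mul_ne_top hC (tsum_ofReal_mul_renewal_ne_top hΘ hf_nonneg hf_anti hf_int)
  · refine (hQ.lintegral_tsum_ofReal_le hf_anti).trans (ENNReal.tsum_le_tsum fun a => ?_)
    refine (mul_right_mono (hwindow hx hQ a)).trans_eq ?_
    ring

theorem tendsto_tsum_mul_min_one_div {α : Type*} {l : Filter α} [l.IsCountablyGenerated]
    {r : α → ℝ≥0∞} (hr : Tendsto r l (𝓝 ∞)) {u v : ℕ → ℝ≥0∞} (hu : ∑' a, u a ≠ ∞)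
    (hv : ∀ a, v a ≠ ∞) : Tendsto (fun x => ∑' a, u a * min 1 (v a / r x)) l (𝓝 0) := by
  have hterm (a : ℕ) : Tendsto (fun x => u a * min 1 (v a / r x)) l (𝓝 0) := by
    have hdiv : Tendsto (fun x => v a / r x) l (𝓝 0) := by
      simpa using ENNReal.Tendsto.const_div hr (.inr (hv a))
    have hmin : Tendsto (fun x => min 1 (v a / r x)) l (𝓝 0) := by
      simpa using (tendsto_const_nhds (x := (1 : ℝ≥0∞))).min hdiv
    simpa using ENNReal.Tendsto.const_mul (a := u a) hmin
      (.inr (ne_top_of_le_ne_top hu (ENNReal.le_tsum a)))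
  have h := tendsto_lintegral_filter_of_dominated_convergence (μ := Measure.count) u
    (.of_forall fun x => measurable_of_countable fun a => u a * min 1 (v a / r x))
    (.of_forall fun x => .of_forall fun a => mul_le_of_le_one_right' (min_le_left _ _))
    (by rwa [lintegral_count]) (.of_forall hterm)
  simpa only [lintegral_count, tsum_zero] using h

theorem tendsto_renewal (hΘ : IsBoundaryCase Θ) : Tendsto (renewal Θ) atTop (𝓝 ∞) := by
  have := isProbabilityMeasure_spineStep hΘ
  rw [renewal_eq_descRenewal hΘ]
  exact tendsto_descRenewal hΘ.isCenteredStep_displacement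

end Potential

end SpinalBRW

end

theorem mainTheorem4
    (Θ : Measure SpinalBRW.Offspring) (hΘ : SpinalBRW.IsBoundaryCase Θ)
    (f : ℝ → ℝ) (hf_nonneg : ∀ y, 0 ≤ y → 0 ≤ f y)
    (hf_bdd : ∃ C : ℝ, ∀ y, 0 ≤ y → f y ≤ C)
    (hf_anti : AntitoneOn f (Set.Ici 0))
    (hf_int : IntegrableOn (fun y => y * f y) (Set.Ioi 0)) :
    (∀ x : ℝ, 0 ≤ x → ∃ Q : Measure SpinalBRW.Path, SpinalBRW.IsPositiveSpineLaw Θ x Q) ∧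
    ∀ Pplus : ℝ → Measure SpinalBRW.Path,
      (∀ x : ℝ, 0 ≤ x → SpinalBRW.IsPositiveSpineLaw Θ x (Pplus x)) →
      Tendsto
        (fun x : ℝ => ∫⁻ ω, ∑' k : ℕ, ENNReal.ofReal (f (SpinalBRW.spinePos k ω)) ∂(Pplus x))
        atTop (𝓝 0) ∧
      ∀ x : ℝ, 0 ≤ x →
        ∫⁻ ω, ∑' k : ℕ, ENNReal.ofReal (f (SpinalBRW.spinePos k ω)) ∂(Pplus x) < ∞ := by
  refine ⟨fun x hx => SpinalBRW.exists_isPositiveSpineLaw hΘ hx, fun Pplus hP => ?_⟩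
  obtain ⟨u, v, hu, hv, hbound⟩ :=
    SpinalBRW.exists_lintegral_tsum_bound hΘ hf_nonneg hf_anti hf_int
  constructor
  · have hmajorant : Tendsto (fun x => ∑' a, u a * min 1 (v a / SpinalBRW.renewal Θ x))
        atTop (𝓝 0) :=
      SpinalBRW.tendsto_tsum_mul_min_one_div (SpinalBRW.tendsto_renewal hΘ) hu hv
    refine tendsto_of_tendsto_of_tendsto_of_le_of_le' tendsto_const_nhds hmajorant
      (.of_forall fun x => bot_le) ?_
    filter_upwards [eventually_ge_atTop 0] with x hx using hbound hx (hP x hx)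
  · intro x hx
    calc _ ≤ ∑' a, u a * min 1 (v a / SpinalBRW.renewal Θ x) := hbound hx (hP x hx)
      _ ≤ ∑' a, u a :=
        ENNReal.tsum_le_tsum fun a => mul_le_of_le_one_right' (min_le_left _ _)
      _ < ∞ := hu.lt_top
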